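/- Let $\mu$ be a probability distribution on $\mathbb{R}$ such that a random variable $X_1$ with law $\mu$ satisfies $\mathbb{E}X_1=0$, $\mathbb{E}X_1^2=1$, $\mathbb{E}X_1^3=\gamma$ and $\mathbb{E}X_1^4<\infty$. Suppose that $\mu$ has a compactly supported continuous component with density bounded away from $0$: that is, $\mu=pF_1+(1-p)F_2$ for some $p\in(0,1]$ and probability distributions $F_1,F_2$ on $\mathbb{R}$ (with no condition on $F_2$), where $F_1$ has a density $f$ with respect to Lebesgue measure for which there are a compact set $K\subset\mathbb{R}$ and a constant $c>0$ with $f\ge c$ on $K$ and $f=0$ outside $K$. Then there is a constant $C$, depending only on $\mu$, such that for every $n\ge 1$, all i.i.d. random variables $X_1,\dots,X_n$ with law $\mu$, with $W=\frac{1}{\sqrt n}\sum_{i=1}^n X_i$, and every (Borel measurable) $h:\mathbb{R}\to\mathbb{R}$ with $\|h\|_\infty=\sup_x|h(x)|\le 1$, $$\Big|\mathbb{E}h(W)-\mathbb{E}h(Z)-\frac{\gamma}{6\sqrt n}\,\mathbb{E}\big[(Z^3-3Z)h(Z)\big]\Big|\le\frac{C}{n},$$ where $Z\sim N(0,1)$.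 Moreover, when $h(w)=1_{\{w\le x\}}$ for some $x\in\mathbb{R}$, the correction term $\frac{\gamma}{6\sqrt n}\mathbb{E}[(Z^3-3Z)h(Z)]$ equals $$\frac{\gamma}{6\sqrt{2\pi n}}\int_{-\infty}^x (y^3-3y)\,e^{-y^2/2}\,dy.$$ -/

import Mathlib

open MeasureTheory ProbabilityTheory
open scoped NNReal ENNReal

/-- The measure `F` on the real line is absolutely continuous with a
density `f` which vanishes off some compact set `K` and is bounded away from `0` on `K`. -/
def HasCompactDensityBoundedBelow (F : Measure ℝ) : Prop :=
  ∃ (f : ℝ → ℝ) (K : Set ℝ) (c : ℝ),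
    Measurable f ∧ IsCompact K ∧ 0 < c ∧
    (∀ x ∈ K, c ≤ f x) ∧ (∀ x ∉ K, f x = 0) ∧
    F = volume.withDensity (fun x => ENNReal.ofReal (f x))

/-- The law `μ` has a compactly supported continuous component with density bounded away from `0`:
it is a mixture `p F₁ + q F₂` of two probability laws, with `p > 0` and `p + q = 1`, where `F₁` is
compactly supported and has a density that is bounded away from `0` on its support. Nothing is
required of `F₂`, which may be discrete or singular. -/
def HasContinuousComponent (μ : Measure ℝ) : Prop :=
  ∃ (p q : ℝ≥0) (F₁ F₂ : Measure ℝ),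
    0 < p ∧ p + q = 1 ∧ IsProbabilityMeasure F₁ ∧ IsProbabilityMeasure F₂ ∧
    HasCompactDensityBoundedBelow F₁ ∧
    μ = p • F₁ + q • F₂

/-! Let a and b be the operators f ↦ E f(x + Y) on bounded Borel functions, with Y of law μ or
standard normal. They commute, are contractions for the sup norm, and their n-th powers average over
sums of n independent copies. Expanding to second order (`Commute.pow_sub_pow_sub_mul`), a^n - b^n
is n(a - b)b^(n-1) plus a sum of terms (l+1)(a - b)²b^l a^(n-2-l).

Three matching moments (orders 0, 1, 2) make a - b a third order differential operator up to
constants. If m-th powers of a or b smooth at scale √m, then (a - b)a^m and (a - b)b^m have norm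
O(m^(-3/2)). Each quadratic term then has norm O(n · n^(-3)), and the n terms sum to O(1/n). In the
linear term, Taylor expansion to fourth order leaves γ/6 times a third derivative of a Gaussian
average, with error O(n^(-2)) before the factor n. Rescaling by 1/√n turns that derivative into the
Hermite term.

Smoothing comes from the continuous component. The law μ ∗ μ dominates a multiple of a law U whose
density has finite Fisher information. A k-fold convolution of U carries a derivative of cost
O(1/√k): the derivative can be placed on any of the k factors, and averaging over the choice
replaces one score by a mean of k independent centred scores (`smoothBy_convOp_pow`). Binomial
expansion transfers this to powers of μ ∗ μ, the part free of U being exponentially small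
(`HasContinuousComponent.smoothingPowers`). -/

open Filter Topology

/-! ### Bounded Borel functions -/

/-- The space of bounded Borel measurable functions on the real line. -/
def bddMeasSubmodule : Submodule ℝ (ℝ → ℝ) where
  carrier := {f | Measurable f ∧ ∃ M, ∀ x, |f x| ≤ M}
  add_mem' := by
    rintro f g ⟨hf, M, hM⟩ ⟨hg, N, hN⟩
    exact ⟨hf.add hg, M + N, fun x => (abs_add_le _ _).trans (add_le_add (hM x) (hN x))⟩
  zero_mem' := ⟨measurable_const, 0, by simp⟩
  smul_mem' := by
    rintro c f ⟨hf, M, hM⟩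
    refine ⟨hf.const_smul c, |c| * M, fun x => ?_⟩
    simp only [Pi.smul_apply, smul_eq_mul, abs_mul]
    exact mul_le_mul_of_nonneg_left (hM x) (abs_nonneg c)

/-- The type of bounded Borel measurable functions on the real line. -/
def BddMeas : Type := bddMeasSubmodule

noncomputable instance : AddCommGroup BddMeas := inferInstanceAs (AddCommGroup bddMeasSubmodule)

noncomputable instance : Module ℝ BddMeas := inferInstanceAs (Module ℝ bddMeasSubmodule)

namespace BddMeas

instance : CoeFun BddMeas (fun _ => ℝ → ℝ) := ⟨fun f => f.1⟩

@[ext] lemma ext' {f g : BddMeas} (h : ∀ x, f x = g x) : f = g := Subtype.ext (funext h)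

lemma measurable (f : BddMeas) : Measurable f.1 := f.2.1

lemma exists_bound (f : BddMeas) : ∃ M, ∀ x, |f x| ≤ M := f.2.2

@[simp] lemma add_apply (f g : BddMeas) (x : ℝ) : (f + g) x = f x + g x := rfl
@[simp] lemma smul_apply (c : ℝ) (f : BddMeas) (x : ℝ) : (c • f) x = c * f x := rfl
@[simp] lemma zero_apply (x : ℝ) : (0 : BddMeas) x = 0 := rfl

lemma integrable_mul (f : BddMeas) {α : Type*} [MeasurableSpace α] {ρ : Measure α} {v : α → ℝ}
    (hv : Integrable v ρ) {φ : α → ℝ} (hφ : Measurable φ) :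
    Integrable (fun y => f (φ y) * v y) ρ := by
  obtain ⟨M, hM⟩ := f.exists_bound
  exact hv.bdd_mul (c := M) (f.measurable.comp hφ).aestronglyMeasurable
    (Eventually.of_forall fun y => hM _)

lemma integrable_comp (f : BddMeas) {α : Type*} [MeasurableSpace α] {ρ : Measure α}
    [IsFiniteMeasure ρ] {φ : α → ℝ} (hφ : AEMeasurable φ ρ) :
    Integrable (fun y => f (φ y)) ρ := by
  obtain ⟨M, hM⟩ := f.exists_bound
  exact Integrable.of_bound (f.measurable.comp_aemeasurable hφ).aestronglyMeasurable M
    (Eventually.of_forall fun y => hM _)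

end BddMeas

/-- `BoundedBy M f` says that the sup norm of `f` is at most `M`. -/
def BddMeas.BoundedBy (M : ℝ) (f : BddMeas) : Prop := ∀ x, |f x| ≤ M

lemma BddMeas.BoundedBy.nonneg {M : ℝ} {f : BddMeas} (h : f.BoundedBy M) : 0 ≤ M :=
  (abs_nonneg _).trans (h 0)

open BddMeas

lemma abs_integral_le_of_bound {α : Type*} [MeasurableSpace α] {ρ : Measure α} [IsFiniteMeasure ρ]
    {f : α → ℝ} {M : ℝ} (h : ∀ x, |f x| ≤ M) : |∫ x, f x ∂ρ| ≤ ρ.real Set.univ * M := by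
  have := norm_integral_le_of_norm_le_const (μ := ρ) (f := f) (Eventually.of_forall h)
  rwa [Real.norm_eq_abs, mul_comm] at this

/-! ### Convolution operators and their sup norm bounds -/

/-- Averaging a bounded function over the translates distributed according to `ρ`. -/
noncomputable def convOp (ρ : Measure ℝ) [IsFiniteMeasure ρ] : Module.End ℝ BddMeas where
  toFun f := ⟨fun x => ∫ y, f (x + y) ∂ρ, by
    constructor
    · have h : StronglyMeasurable (fun p : ℝ × ℝ => f (p.1 + p.2)) :=
        (f.measurable.comp (measurable_fst.add measurable_snd)).stronglyMeasurable
      exact h.integral_prod_right'.measurable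
    · obtain ⟨M, hM⟩ := f.exists_bound
      exact ⟨_, fun x => abs_integral_le_of_bound fun y => hM _⟩⟩
  map_add' f g := by
    ext x
    exact integral_add (f.integrable_comp (by fun_prop)) (g.integrable_comp (by fun_prop))
  map_smul' c f := by
    ext x
    exact integral_const_mul _ _

lemma convOp_apply (ρ : Measure ℝ) [IsFiniteMeasure ρ] (f : BddMeas) (x : ℝ) :
    convOp ρ f x = ∫ y, f (x + y) ∂ρ := rfl

lemma convOp_mul (ρ σ : Measure ℝ) [IsFiniteMeasure ρ] [IsFiniteMeasure σ] :
    convOp ρ * convOp σ = convOp (ρ ∗ σ) := by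
  ext f x
  change ∫ y, (∫ z, f (x + y + z) ∂σ) ∂ρ = ∫ w, f (x + w) ∂(ρ ∗ σ)
  rw [integral_conv (f.integrable_comp (by fun_prop))]
  simp only [add_assoc]

lemma convOp_commute (ρ σ : Measure ℝ) [IsFiniteMeasure ρ] [IsFiniteMeasure σ] :
    Commute (convOp ρ) (convOp σ) := by
  unfold Commute SemiconjBy
  rw [convOp_mul, convOp_mul]
  congr 1
  exact Measure.conv_comm _ _

lemma convOp_add (ρ σ : Measure ℝ) [IsFiniteMeasure ρ] [IsFiniteMeasure σ] :
    convOp (ρ + σ) = convOp ρ + convOp σ := by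
  ext f x
  exact integral_add_measure (f.integrable_comp (by fun_prop)) (f.integrable_comp (by fun_prop))

lemma convOp_smul (c : ℝ≥0) (ρ : Measure ℝ) [IsFiniteMeasure ρ] :
    convOp (c • ρ) = (c : ℝ) • convOp ρ := by
  ext f x
  exact integral_smul_nnreal_measure _ _

/-- An upper bound for the operator norm with respect to the sup norm. -/
def OpBound (A : Module.End ℝ BddMeas) (c : ℝ) : Prop :=
  ∀ (f : BddMeas) (M : ℝ), f.BoundedBy M → (A f).BoundedBy (c * M)

namespace OpBound

variable {A B : Module.End ℝ BddMeas} {c d : ℝ}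

lemma mono (hA : OpBound A c) (h : c ≤ d) : OpBound A d := fun f M hf x =>
  (hA f M hf x).trans (mul_le_mul_of_nonneg_right h hf.nonneg)

lemma add (hA : OpBound A c) (hB : OpBound B d) : OpBound (A + B) (c + d) := fun f M hf x => by
  rw [add_mul]
  exact (abs_add_le _ _).trans (add_le_add (hA f M hf x) (hB f M hf x))

lemma sub (hA : OpBound A c) (hB : OpBound B d) : OpBound (A - B) (c + d) := fun f M hf x => by
  rw [add_mul]
  exact (abs_sub _ _).trans (add_le_add (hA f M hf x) (hB f M hf x))

lemma mul (hA : OpBound A c) (hB : OpBound B d) : OpBound (A * B) (c * d) := fun f M hf => by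
  rw [mul_assoc]
  exact hA _ _ (hB f M hf)

lemma one : OpBound 1 1 := fun f M hf => by simpa using hf

lemma zero : OpBound 0 0 := fun f M _ x => by simp

lemma pow (hA : OpBound A c) (n : ℕ) : OpBound (A ^ n) (c ^ n) := by
  induction n with
  | zero => simpa using one
  | succ n ih => rw [pow_succ, pow_succ]; exact ih.mul hA

lemma smul (hA : OpBound A c) (r : ℝ) : OpBound (r • A) (|r| * c) := fun f M hf x => by
  rw [mul_assoc]
  change |r * A f x| ≤ _
  rw [abs_mul]
  exact mul_le_mul_of_nonneg_left (hA f M hf x) (abs_nonneg r)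

lemma sum {ι : Type*} (s : Finset ι) {A : ι → Module.End ℝ BddMeas} {c : ι → ℝ}
    (h : ∀ i ∈ s, OpBound (A i) (c i)) : OpBound (∑ i ∈ s, A i) (∑ i ∈ s, c i) := by
  classical
  induction s using Finset.induction_on with
  | empty => simpa using zero
  | insert a s ha ih =>
    rw [Finset.sum_insert ha, Finset.sum_insert ha]
    exact (h a (by simp)).add (ih fun i hi => h i (by simp [hi]))

lemma pow_one (hA : OpBound A 1) (n : ℕ) : OpBound (A ^ n) 1 := by
  simpa using hA.pow n

end OpBound

lemma opBound_convOp (ρ : Measure ℝ) [IsFiniteMeasure ρ] :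
    OpBound (convOp ρ) (ρ.real Set.univ) := fun _ _ hf _ =>
  abs_integral_le_of_bound fun _ => hf _

lemma opBound_convOp_one (ρ : Measure ℝ) [IsProbabilityMeasure ρ] : OpBound (convOp ρ) 1 := by
  simpa using opBound_convOp ρ

/-! ### Differentiation and smoothing operators -/

/-- `g` is the derivative of `f`. -/
def IsDeriv (f g : BddMeas) : Prop := ∀ x, HasDerivAt f.1 (g x) x

lemma IsDeriv.add {f f' g g' : BddMeas} (hf : IsDeriv f f') (hg : IsDeriv g g') :
    IsDeriv (f + g) (f' + g') := fun x => (hf x).add (hg x)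

lemma IsDeriv.const_smul {f f' : BddMeas} (c : ℝ) (hf : IsDeriv f f') :
    IsDeriv (c • f) (c • f') := fun x => (hf x).const_mul c

lemma IsDeriv.zero : IsDeriv 0 0 := fun x => hasDerivAt_const x 0

lemma IsDeriv.convOp {f f' : BddMeas} (hf : IsDeriv f f') (ρ : Measure ℝ) [IsFiniteMeasure ρ] :
    IsDeriv (convOp ρ f) (convOp ρ f') := by
  intro x
  obtain ⟨M, hM⟩ := f'.exists_bound
  refine (hasDerivAt_integral_of_dominated_loc_of_deriv_le (μ := ρ) (s := Set.univ)
    (F := fun x y => f (x + y)) (F' := fun x y => f' (x + y)) (bound := fun _ => M)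
    Filter.univ_mem ?_ ?_ ?_ ?_ ?_ ?_).2
  · exact Eventually.of_forall fun x =>
      (f.integrable_comp (φ := fun y => x + y) (by fun_prop)).aestronglyMeasurable
  · exact f.integrable_comp (φ := fun y => x + y) (by fun_prop)
  · exact (f'.integrable_comp (φ := fun y => x + y) (by fun_prop)).aestronglyMeasurable
  · exact Eventually.of_forall fun y x _ => hM _
  · exact integrable_const _
  · exact Eventually.of_forall fun y x _ => (hf (x + y)).comp_add_const x y

/-- The operator `A` commutes with differentiation. -/
def PreservesDeriv (A : Module.End ℝ BddMeas) : Prop :=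
  ∀ f f' : BddMeas, IsDeriv f f' → IsDeriv (A f) (A f')

namespace PreservesDeriv

variable {A B : Module.End ℝ BddMeas}

lemma add (hA : PreservesDeriv A) (hB : PreservesDeriv B) : PreservesDeriv (A + B) :=
  fun f f' h => (hA f f' h).add (hB f f' h)

lemma smul (hA : PreservesDeriv A) (c : ℝ) : PreservesDeriv (c • A) :=
  fun f f' h => (hA f f' h).const_smul c

lemma mul (hA : PreservesDeriv A) (hB : PreservesDeriv B) : PreservesDeriv (A * B) :=
  fun f f' h => hA _ _ (hB f f' h)

lemma one : PreservesDeriv 1 := fun _ _ h => h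

lemma zero : PreservesDeriv 0 := fun _ _ _ => IsDeriv.zero

lemma pow (hA : PreservesDeriv A) (n : ℕ) : PreservesDeriv (A ^ n) := by
  induction n with
  | zero => simpa using one
  | succ n ih => rw [pow_succ]; exact ih.mul hA

lemma sum {ι : Type*} (s : Finset ι) {A : ι → Module.End ℝ BddMeas}
    (h : ∀ i ∈ s, PreservesDeriv (A i)) : PreservesDeriv (∑ i ∈ s, A i) := by
  classical
  induction s using Finset.induction_on with
  | empty => simpa using zero
  | insert a s ha ih =>
    rw [Finset.sum_insert ha]
    exact (h a (by simp)).add (ih fun i hi => h i (by simp [hi]))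

lemma convOp (ρ : Measure ℝ) [IsFiniteMeasure ρ] : PreservesDeriv (convOp ρ) :=
  fun _ _ h => h.convOp ρ

end PreservesDeriv

/-- `A` maps bounded functions to differentiable ones, the derivative being at most `e` times as
large as the function. -/
def SmoothBy (A : Module.End ℝ BddMeas) (e : ℝ) : Prop :=
  ∀ (f : BddMeas) (M : ℝ), f.BoundedBy M → ∃ g : BddMeas, IsDeriv (A f) g ∧ g.BoundedBy (e * M)

namespace SmoothBy

variable {A B : Module.End ℝ BddMeas} {e d c : ℝ}

lemma mono (hA : SmoothBy A e) (h : e ≤ d) : SmoothBy A d := fun f M hf => by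
  obtain ⟨g, hg, hb⟩ := hA f M hf
  exact ⟨g, hg, fun x => (hb x).trans (mul_le_mul_of_nonneg_right h hf.nonneg)⟩

lemma add (hA : SmoothBy A e) (hB : SmoothBy B d) : SmoothBy (A + B) (e + d) := fun f M hf => by
  obtain ⟨g, hg, hb⟩ := hA f M hf
  obtain ⟨g', hg', hb'⟩ := hB f M hf
  exact ⟨g + g', hg.add hg', fun x => by
    rw [add_mul]; exact (abs_add_le _ _).trans (add_le_add (hb x) (hb' x))⟩

lemma smul (hA : SmoothBy A e) (r : ℝ) : SmoothBy (r • A) (|r| * e) := fun f M hf => by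
  obtain ⟨g, hg, hb⟩ := hA f M hf
  refine ⟨r • g, hg.const_smul r, fun x => ?_⟩
  rw [mul_assoc, smul_apply, abs_mul]
  exact mul_le_mul_of_nonneg_left (hb x) (abs_nonneg r)

lemma zero : SmoothBy 0 0 := fun f M _ => ⟨0, IsDeriv.zero, fun x => by simp⟩

lemma mul_right (hA : SmoothBy A e) (hB : OpBound B c) : SmoothBy (A * B) (e * c) :=
  fun f M hf => by
    rw [mul_assoc]
    exact hA (B f) _ (hB f M hf)

lemma sum {ι : Type*} (s : Finset ι) {A : ι → Module.End ℝ BddMeas} {e : ι → ℝ}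
    (h : ∀ i ∈ s, SmoothBy (A i) (e i)) : SmoothBy (∑ i ∈ s, A i) (∑ i ∈ s, e i) := by
  classical
  induction s using Finset.induction_on with
  | empty => simpa using zero
  | insert a s ha ih =>
    rw [Finset.sum_insert ha, Finset.sum_insert ha]
    exact (h a (by simp)).add (ih fun i hi => h i (by simp [hi]))

end SmoothBy

/-- The chain of the first derivatives of `f`, the `k`-th one being at most `e ^ k * M`. -/
lemma SmoothBy.exists_derivs {A : Module.End ℝ BddMeas} {e : ℝ} (hA : SmoothBy A e)
    (hP : PreservesDeriv A) (n : ℕ) (f : BddMeas) (M : ℝ)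
    (hf : f.BoundedBy M) :
    ∃ g : ℕ → BddMeas, g 0 = (A ^ n) f ∧ (∀ k < n, IsDeriv (g k) (g (k + 1))) ∧
      (g n).BoundedBy (e ^ n * M) := by
  induction n generalizing f M with
  | zero => exact ⟨fun _ => f, rfl, by simp, by simpa using hf⟩
  | succ n ih =>
    -- The innermost factor `A` pays for one derivative; the other `n` factors commute with
    -- differentiation and act on `f'`.
    obtain ⟨f', hf', hb⟩ := hA f M hf
    obtain ⟨g, hg0, hg, hgb⟩ := ih f' (e * M) hb
    refine ⟨fun k => Nat.casesOn k ((A ^ (n + 1)) f) g, rfl, ?_, ?_⟩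
    · rintro (_ | k) hk
      · change IsDeriv ((A ^ (n + 1)) f) (g 0)
        rw [hg0, pow_succ]
        exact hP.pow n _ _ hf'
      · exact hg k (by omega)
    · intro x
      have := hgb x
      simpa [pow_succ, mul_assoc] using this

/-! ### Averaging against integrable densities -/

/-- Translations are continuous in `L¹`. -/
lemma tendsto_integral_abs_translate_sub {v : ℝ → ℝ} (hv : Integrable v) (a : ℝ) :
    Tendsto (fun t => ∫ y, |v (y - t) - v (y - a)|) (𝓝 a) (𝓝 0) := by
  have hmem : MemLp v 1 (volume : Measure ℝ) := memLp_one_iff_integrable.2 hv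
  have : Fact ((1 : ℝ≥0∞) ≠ ∞) := ⟨ENNReal.one_ne_top⟩
  have hc : Continuous (fun t : ℝ => DomAddAct.mk (-t) +ᵥ hmem.toLp v) := by
    have h1 : Continuous (fun t : ℝ => DomAddAct.mk (-t)) :=
      DomAddAct.continuous_mk.comp continuous_neg
    exact h1.vadd continuous_const
  have ht := tendsto_iff_norm_sub_tendsto_zero.1 (hc.tendsto a)
  refine ht.congr fun t => ?_
  have hmp : ∀ t : ℝ, MeasurePreserving (fun x : ℝ => (-t) +ᵥ x) volume volume := fun t =>
    measurePreserving_vadd (-t) volume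
  rw [DomAddAct.mk_vadd_toLp, DomAddAct.mk_vadd_toLp, ← MemLp.toLp_sub, Lp.norm_toLp,
    eLpNorm_one_eq_lintegral_enorm, integral_eq_lintegral_of_nonneg_ae]
  · congr 1
    refine lintegral_congr fun y => ?_
    rw [← Real.enorm_abs, Real.enorm_eq_ofReal (abs_nonneg _)]
    simp [sub_eq_neg_add]
  · exact Eventually.of_forall fun y => abs_nonneg _
  · exact ((hv.comp_sub_right t).sub (hv.comp_sub_right a)).aestronglyMeasurable.norm

lemma integral_bddMeas_mul_translate (f : BddMeas) (v : ℝ → ℝ) (x : ℝ) :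
    ∫ y, f (x + y) * v y = ∫ y, f y * v (y - x) := by
  rw [← integral_sub_right_eq_self (fun y => f (x + y) * v y) x]
  simp

/-- The function `f` is only measurable, so the translation is moved onto `v`, where it is
continuous in L¹. -/
lemma continuous_integral_bddMeas_mul (f : BddMeas) {v : ℝ → ℝ} (hv : Integrable v) :
    Continuous fun x => ∫ y, f (x + y) * v y := by
  simp_rw [integral_bddMeas_mul_translate]
  obtain ⟨M, hM⟩ := f.exists_bound
  rw [continuous_iff_continuousAt]
  intro a
  rw [ContinuousAt, tendsto_iff_norm_sub_tendsto_zero]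
  have h0 := (tendsto_integral_abs_translate_sub hv a).const_mul M
  rw [mul_zero] at h0
  refine squeeze_zero (fun _ => norm_nonneg _) (fun t => ?_) h0
  rw [← integral_sub (f.integrable_mul (φ := fun y => y) (hv.comp_sub_right t) measurable_id)
    (f.integrable_mul (φ := fun y => y) (hv.comp_sub_right a) measurable_id), ← integral_const_mul]
  refine norm_integral_le_of_norm_le
    (((hv.comp_sub_right t).sub (hv.comp_sub_right a)).abs.const_mul M)
    (Eventually.of_forall fun y => ?_)
  rw [← mul_sub, norm_mul]
  exact mul_le_mul_of_nonneg_right (hM y) (norm_nonneg _)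

/-- Averaging a bounded function against an integrable signed density. -/
noncomputable def kernelOp (v : ℝ → ℝ) (hv : Integrable v) : Module.End ℝ BddMeas where
  toFun f := ⟨fun x => ∫ y, f (x + y) * v y, by
    refine ⟨(continuous_integral_bddMeas_mul f hv).measurable, ?_⟩
    obtain ⟨M, hM⟩ := f.exists_bound
    refine ⟨∫ y, M * |v y|, fun x => ?_⟩
    rw [← Real.norm_eq_abs]
    refine norm_integral_le_of_norm_le (hv.abs.const_mul M) (Eventually.of_forall fun y => ?_)
    rw [norm_mul]
    exact mul_le_mul_of_nonneg_right (hM _) (norm_nonneg _)⟩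
  map_add' f g := by
    ext x
    refine Eq.trans ?_ (integral_add (f.integrable_mul hv (φ := fun y => x + y) (by fun_prop))
      (g.integrable_mul hv (φ := fun y => x + y) (by fun_prop)))
    simp only [BddMeas.add_apply, add_mul]
  map_smul' c f := by
    ext x
    refine Eq.trans ?_ (integral_const_mul c (fun y => f (x + y) * v y))
    simp only [BddMeas.smul_apply, mul_assoc]

lemma kernelOp_apply {v : ℝ → ℝ} (hv : Integrable v) (f : BddMeas) (x : ℝ) :
    kernelOp v hv f x = ∫ y, f (x + y) * v y := rfl

/-- Averaging against a density is differentiable, with the derivative falling on the density. -/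
lemma isDeriv_kernelOp {v v' : ℝ → ℝ} (hv : Integrable v) (hv' : Integrable v')
    (hd : ∀ x, HasDerivAt v (v' x) x) (f : BddMeas) :
    IsDeriv (kernelOp v hv f) (-(kernelOp v' hv' f)) := by
  have hH : Continuous fun s => ∫ y, f y * v' (y - s) := by
    simpa only [← integral_bddMeas_mul_translate] using continuous_integral_bddMeas_mul f hv'
  have hm' : StronglyMeasurable v' := by
    have : v' = deriv v := funext fun x => (hd x).deriv.symm
    rw [this]
    exact (measurable_deriv v).stronglyMeasurable
  -- There is no dominating function for differentiating under the integral. The increment is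
  -- written by Fubini as an integral of the candidate derivative, which is continuous by `hH`, and
  -- the fundamental theorem of calculus concludes.
  have key : ∀ a b, (kernelOp v hv f) b - (kernelOp v hv f) a
      = ∫ s in a..b, -∫ y, f y * v' (y - s) := by
    intro a b
    rw [kernelOp_apply, kernelOp_apply, integral_bddMeas_mul_translate,
      integral_bddMeas_mul_translate,
      ← integral_sub (f.integrable_mul (φ := fun y => y) (hv.comp_sub_right b) measurable_id)
      (f.integrable_mul (φ := fun y => y) (hv.comp_sub_right a) measurable_id)]
    have h1 : ∀ y, f y * v (y - b) - f y * v (y - a)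
        = -∫ s in a..b, f y * v' (y - s) := by
      intro y
      rw [intervalIntegral.integral_const_mul, intervalIntegral.integral_comp_sub_left (fun s => v' s) y,
        intervalIntegral.integral_eq_sub_of_hasDerivAt (fun x _ => hd x) hv'.intervalIntegrable]
      ring
    simp_rw [h1]
    rw [integral_neg, intervalIntegral.integral_neg]
    congr 1
    have hint : ∀ ρ : Measure ℝ, [IsFiniteMeasure ρ] →
        Integrable (fun p : ℝ × ℝ => f p.1 * v' (p.1 - p.2)) ((volume : Measure ℝ).prod ρ) := by
      intro ρ _
      refine f.integrable_mul (φ := Prod.fst) ?_ measurable_fst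
      have hm2 : StronglyMeasurable fun p : ℝ × ℝ => v' (p.1 - p.2) :=
        hm'.comp_measurable (by fun_prop)
      rw [integrable_prod_iff' hm2.aestronglyMeasurable]
      refine ⟨Eventually.of_forall fun s => hv'.comp_sub_right s, ?_⟩
      simp_rw [integral_sub_right_eq_self (fun y => ‖v' y‖)]
      exact integrable_const _
    simp only [intervalIntegral]
    have swap : ∀ ρ : Measure ℝ, [IsFiniteMeasure ρ] →
        ∫ y, ∫ s, f y * v' (y - s) ∂ρ = ∫ s, (∫ y, f y * v' (y - s)) ∂ρ :=
      fun ρ _ => integral_integral_swap (hint ρ)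
    rw [integral_sub, swap, swap]
    · exact (hint _).integral_prod_left
    · exact (hint _).integral_prod_left
  intro x
  have h2 := (hH.neg.integral_hasStrictDerivAt x x).hasDerivAt.add_const (kernelOp v hv f x)
  have h3 : (-(kernelOp v' hv' f)) x = -∫ y, f y * v' (y - x) := by
    rw [← integral_bddMeas_mul_translate]; rfl
  rw [h3]
  refine h2.congr_of_eventuallyEq (Eventually.of_forall fun b => ?_)
  have := key x b
  change kernelOp v hv f b = (∫ s in x..b, -∫ y, f y * v' (y - s)) + kernelOp v hv f x
  linarith

/-! ### Sums of independent variables as operator powers -/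

section Iid

variable {Ω ι : Type*} [MeasurableSpace Ω] {P : Measure Ω} [IsProbabilityMeasure P]
  {ρ : Measure ℝ} [IsProbabilityMeasure ρ] {X : ι → Ω → ℝ}

/-- Conditioning on one of two independent variables. -/
lemma integral_bddMeas_add_mul_of_indepFun {X Y : Ω → ℝ} (hX : HasLaw X ρ P)
    (hY : AEMeasurable Y P) (hXY : IndepFun X Y P) (f : BddMeas) {w : ℝ → ℝ}
    (hw : Measurable w) (hwi : Integrable w ρ) (x : ℝ) :
    ∫ ω, f (x + (X ω + Y ω)) * w (X ω) ∂P = ∫ y, (∫ ω, f (x + y + Y ω) ∂P) * w y ∂ρ := by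
  have hYp : IsProbabilityMeasure (P.map Y) := Measure.isProbabilityMeasure_map hY
  have hmap := (indepFun_iff_map_prod_eq_prod_map_map hX.aemeasurable hY).1 hXY
  rw [hX.map_eq] at hmap
  have hF : Measurable fun p : ℝ × ℝ => f (x + (p.1 + p.2)) * w p.1 :=
    (f.measurable.comp (by fun_prop : Measurable fun p : ℝ × ℝ => x + (p.1 + p.2))).mul
      (hw.comp measurable_fst)
  have h1 := integral_map (hX.aemeasurable.prodMk hY) (f := fun p : ℝ × ℝ =>
    f (x + (p.1 + p.2)) * w p.1) hF.aestronglyMeasurable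
  rw [← h1, hmap, integral_prod]
  · refine integral_congr_ae (Eventually.of_forall fun y => ?_)
    simp only
    rw [integral_mul_const, ← integral_map (f := fun z => f (x + y + z)) hY]
    · simp only [add_assoc]
    · exact (f.measurable.comp (by fun_prop)).aestronglyMeasurable
  · exact f.integrable_mul (hwi.comp_fst _) (by fun_prop)

/-- Conditioning on `X a` leaves the sum over `s`, which the operator power averages. The weight 1
gives the induction step of `convOp_pow_apply`; the score as weight gives the derivative of a
convolution power. -/
lemma integral_bddMeas_sum_insert_mul [DecidableEq ι] (hX : iIndepFun X P)
    (hl : ∀ i, HasLaw (X i) ρ P) (f : BddMeas) {w : ℝ → ℝ} (hw : Measurable w)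
    (hwi : Integrable w ρ) {a : ι} {s : Finset ι} (ha : a ∉ s)
    (hs : ∀ x, ((convOp ρ) ^ s.card) f x = ∫ ω, f (x + ∑ i ∈ s, X i ω) ∂P) (x : ℝ) :
    ∫ ω, f (x + ∑ i ∈ insert a s, X i ω) * w (X a ω) ∂P
      = ∫ y, ((convOp ρ) ^ s.card) f (x + y) * w y ∂ρ := by
  have hind := (hX.indepFun_finsetSum_of_notMem₀ (fun i => (hl i).aemeasurable) ha).symm
  have hY : AEMeasurable (∑ i ∈ s, X i) P :=
    Finset.aemeasurable_sum _ fun i _ => (hl i).aemeasurable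
  have := integral_bddMeas_add_mul_of_indepFun (hl a) hY hind f hw hwi x
  simp only [Finset.sum_apply] at this
  simp only [Finset.sum_insert ha, hs]
  exact this

/-- Powers of `convOp ρ` average over sums of i.i.d. variables. -/
lemma convOp_pow_apply (hX : iIndepFun X P) (hl : ∀ i, HasLaw (X i) ρ P) (f : BddMeas)
    (s : Finset ι) (x : ℝ) :
    ((convOp ρ) ^ s.card) f x = ∫ ω, f (x + ∑ i ∈ s, X i ω) ∂P := by
  classical
  induction s using Finset.induction_on generalizing x with
  | empty => simp
  | insert a s ha ih =>
    have := integral_bddMeas_sum_insert_mul hX hl f (w := fun _ => 1) measurable_const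
      (integrable_const _) ha ih x
    simp only [mul_one] at this
    rw [this, Finset.card_insert_of_notMem ha, pow_succ']
    rfl

end Iid

/-- The `L¹` norm is at most the `L²` norm. -/
lemma integral_abs_le_sqrt {Ω : Type*} [MeasurableSpace Ω] {P : Measure Ω} [IsProbabilityMeasure P]
    {Y : Ω → ℝ} (hY : MemLp Y 2 P) : ∫ ω, |Y ω| ∂P ≤ √(∫ ω, Y ω ^ 2 ∂P) := by
  apply Real.le_sqrt_of_sq_le
  have h := variance_nonneg |Y| P
  rw [variance_eq_sub hY.abs] at h
  simp only [Pi.pow_apply, Pi.abs_apply, sq_abs] at h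
  linarith

/-! ### Smoothing from finite Fisher information -/

section Fisher

variable {U : Measure ℝ} [IsProbabilityMeasure U] {u w : ℝ → ℝ}

/-- If the density `u` has score `-w` with finite Fisher information, then the convolution powers
of `u` have derivatives of the order `1 / √k` in `L¹`. -/
lemma smoothBy_convOp_pow (hU : U = volume.withDensity fun x => ENNReal.ofReal (u x))
    (hu0 : ∀ x, 0 ≤ u x) (hu : Integrable u) (hd : ∀ x, HasDerivAt u (-(w x * u x)) x)
    (hw : Measurable w) (hw2 : Integrable fun x => w x ^ 2 * u x) {k : ℕ} (hk : 1 ≤ k) :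
    SmoothBy ((convOp U) ^ k) (√(∫ x, w x ^ 2 * u x) / √k) := by
  have hum : Measurable u := by
    have hc : Continuous u := continuous_iff_continuousAt.2 fun x => (hd x).continuousAt
    exact hc.measurable
  have hI : ∀ g : ℝ → ℝ, ∫ y, g y ∂U = ∫ y, g y * u y := by
    intro g
    rw [hU, integral_withDensity_eq_integral_toReal_smul (by fun_prop) (by simp)]
    simp [ENNReal.toReal_ofReal (hu0 _), mul_comm]
  have hII : ∀ g : ℝ → ℝ, Integrable g U ↔ Integrable fun y => g y * u y := by
    intro g
    rw [hU, integrable_withDensity_iff_integrable_smul' (by fun_prop) (by simp)]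
    simp [ENNReal.toReal_ofReal (hu0 _), mul_comm]
  have hwu : Integrable fun x => w x * u x := by
    refine (hw2.add hu).mono' (hw.mul hum).aestronglyMeasurable (Eventually.of_forall fun x => ?_)
    rw [Real.norm_eq_abs, abs_mul, abs_of_nonneg (hu0 x), Pi.add_apply]
    nlinarith [hu0 x, sq_nonneg (|w x| - 1), sq_abs (w x), abs_nonneg (w x)]
  have hconv : convOp U = kernelOp u hu := by
    ext f x
    exact hI _
  have hw0 : ∫ y, w y ∂U = 0 := by
    rw [hI]
    have := integral_eq_zero_of_hasDerivAt_of_integrable hd hwu.neg hu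
    rwa [integral_neg, neg_eq_zero] at this
  have hwL2 : MemLp w 2 U :=
    (memLp_two_iff_integrable_sq hw.aestronglyMeasurable).2 ((hII _).2 hw2)
  have hwi : Integrable w U := (hII _).2 hwu
  intro f M hf
  obtain ⟨j, rfl⟩ : ∃ j, k = j + 1 := ⟨k - 1, by omega⟩
  refine ⟨-(kernelOp _ hwu.neg (((convOp U) ^ j) f)), ?_, ?_⟩
  · rw [pow_succ']
    have := isDeriv_kernelOp hu hwu.neg hd (((convOp U) ^ j) f)
    rw [← hconv] at this
    exact this
  intro x
  set P : Measure (Fin (j + 1) → ℝ) := Measure.pi fun _ => U with hP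
  have hind : iIndepFun (fun (i : Fin (j + 1)) (ω : Fin (j + 1) → ℝ) => ω i) P :=
    iIndepFun_pi (X := fun _ y => y) fun _ => aemeasurable_id
  have hl : ∀ i : Fin (j + 1), HasLaw (fun ω : Fin (j + 1) → ℝ => ω i) U P := fun i =>
    (measurePreserving_eval (fun _ : Fin (j + 1) => U) i).hasLaw
  -- By exchangeability the derivative may be charged to any of the `j + 1` factors, with the same
  -- value.
  have hval : ∀ a : Fin (j + 1), (-(kernelOp _ hwu.neg (((convOp U) ^ j) f))) x
      = ∫ ω, f (x + ∑ i, ω i) * w (ω a) ∂P := by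
    intro a
    have h1 := integral_bddMeas_sum_insert_mul hind hl f hw hwi
      (Finset.notMem_erase a Finset.univ)
      (fun x => convOp_pow_apply hind hl f _ x) x
    rw [Finset.insert_erase (Finset.mem_univ a)] at h1
    have hcard : (Finset.univ.erase a).card = j := by simp
    rw [h1, hI, hcard]
    change -(∫ y, _ * -(w y * u y)) = _
    rw [← integral_neg]
    congr 1 with y
    ring
  have hmem : ∀ a : Fin (j + 1), MemLp (fun ω : Fin (j + 1) → ℝ => w (ω a)) 2 P := fun a =>
    hwL2.comp_measurePreserving (measurePreserving_eval (fun _ : Fin (j + 1) => U) a)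
  have hmean : ∀ a : Fin (j + 1), ∫ ω, w (ω a) ∂P = 0 := fun a => by
    rw [← hw0, ← (hl a).map_eq, integral_map (hl a).aemeasurable hw.aestronglyMeasurable]
  have hsq : ∀ a : Fin (j + 1), ∫ ω, w (ω a) ^ 2 ∂P = ∫ x, w x ^ 2 * u x := fun a => by
    rw [← hI, ← (hl a).map_eq,
      integral_map (f := fun y => w y ^ 2) (hl a).aemeasurable (hw.pow_const 2).aestronglyMeasurable]
  have hsum : MemLp (fun ω : Fin (j + 1) → ℝ => ∑ a, w (ω a)) 2 P :=
    memLp_finsetSum _ fun a _ => hmem a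
  -- The scores are independent and centred, so the second moment of their sum grows linearly and
  -- not quadratically.
  have hvar : ∫ ω, (∑ a, w (ω a)) ^ 2 ∂P = (j + 1 : ℕ) * ∫ x, w x ^ 2 * u x := by
    have h1 := IndepFun.variance_sum (s := Finset.univ) (fun a _ => hmem a)
      (fun a _ b _ hab => (hind.indepFun hab).comp hw hw)
    rw [variance_eq_sub (by convert hsum using 1; ext; simp)] at h1
    simp only [Finset.sum_apply, Pi.pow_apply] at h1
    rw [integral_finsetSum _ fun a _ => (hmem a).integrable (by norm_num)] at h1
    simp only [hmean, Finset.sum_const_zero] at h1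
    have h2 : ∀ a : Fin (j + 1), Var[fun ω : Fin (j + 1) → ℝ => w (ω a); P]
        = ∫ x, w x ^ 2 * u x := fun a => by
      rw [variance_eq_sub (hmem a), hmean, ← hsq a]
      simp
    simp only [h2, Finset.sum_const, Finset.card_univ, Fintype.card_fin, nsmul_eq_mul] at h1
    linarith
  have hint : Integrable (fun ω : Fin (j + 1) → ℝ => ∑ a, w (ω a)) P :=
    hsum.integrable (by norm_num)
  -- Summing over the factors gives `j + 1` times the derivative on the left, but by Cauchy–Schwarz
  -- only order `√(j + 1)` on the right.
  have htot : ((j + 1 : ℕ) : ℝ) * (-(kernelOp _ hwu.neg (((convOp U) ^ j) f))) x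
      = ∫ ω, f (x + ∑ i, ω i) * ∑ a, w (ω a) ∂P := by
    simp_rw [Finset.mul_sum]
    rw [integral_finsetSum]
    · simp [← hval]
    · intro a _
      exact f.integrable_mul (φ := fun ω : Fin (j + 1) → ℝ => x + ∑ i, ω i)
        ((hmem a).integrable (by norm_num)) (by fun_prop)
  have hb : |∫ ω, f (x + ∑ i, ω i) * ∑ a, w (ω a) ∂P|
      ≤ M * √((j + 1 : ℕ) * ∫ x, w x ^ 2 * u x) := by
    rw [← hvar]
    refine le_trans ?_ (mul_le_mul_of_nonneg_left (integral_abs_le_sqrt hsum) hf.nonneg)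
    rw [← integral_const_mul, ← Real.norm_eq_abs]
    refine norm_integral_le_of_norm_le (hint.abs.const_mul M) (Eventually.of_forall fun ω => ?_)
    rw [norm_mul]
    exact mul_le_mul_of_nonneg_right (hf _) (norm_nonneg _)
  have hpos : (0 : ℝ) < ((j + 1 : ℕ) : ℝ) := by positivity
  rw [← htot, abs_mul, abs_of_pos hpos, Real.sqrt_mul hpos.le] at hb
  have hs : (0 : ℝ) < √((j + 1 : ℕ) : ℝ) := Real.sqrt_pos.2 hpos
  have hss := Real.mul_self_sqrt hpos.le
  rw [div_mul_eq_mul_div, le_div_iff₀ hs]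
  rw [← mul_le_mul_iff_right₀ hs]
  calc _ = ((j + 1 : ℕ) : ℝ) * |(-(kernelOp _ hwu.neg (((convOp U) ^ j) f))) x| := by
        rw [mul_comm |_|, ← mul_assoc, hss]
    _ ≤ _ := hb
    _ = _ := by ring

end Fisher

/-! ### A smooth component of the convolution square -/

lemma hasDerivAt_max_zero_sq (t : ℝ) : HasDerivAt (fun t : ℝ => max 0 t ^ 2) (2 * max 0 t) t := by
  rcases lt_trichotomy t 0 with h | rfl | h
  · rw [max_eq_left h.le, mul_zero]
    refine (hasDerivAt_const t (0 : ℝ)).congr_of_eventuallyEq ?_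
    filter_upwards [Iio_mem_nhds h] with s hs
    rw [max_eq_left (le_of_lt hs)]
    norm_num
  · rw [hasDerivAt_iff_isLittleO]
    simp only [max_self, mul_zero, sub_zero, smul_zero]
    refine Asymptotics.IsBigO.trans_isLittleO (g := fun x : ℝ => x ^ 2) ?_ ?_
    · refine Asymptotics.IsBigO.of_bound 1 (Eventually.of_forall fun x => ?_)
      have h0 : |max 0 x| ≤ |x| := by
        rcases le_total 0 x with hx | hx <;> simp [hx]
      simpa using pow_le_pow_left₀ (abs_nonneg _) h0 2
    · exact Asymptotics.isLittleO_pow_id one_lt_two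
  · rw [max_eq_right h.le]
    have h2 : HasDerivAt (fun t : ℝ => t ^ 2) (2 * t) t := by simpa using hasDerivAt_pow 2 t
    refine h2.congr_of_eventuallyEq ?_
    filter_upwards [Ioi_mem_nhds h] with s hs
    rw [max_eq_right (le_of_lt hs)]

/-- On every interval there is a probability density with finite Fisher information. -/
lemma exists_density_finite_fisher (z r : ℝ) (hr : 0 < r) :
    ∃ (u w : ℝ → ℝ) (B : ℝ), (∀ x, 0 ≤ u x) ∧ Integrable u ∧ ∫ x, u x = 1 ∧
      (∀ x, HasDerivAt u (-(w x * u x)) x) ∧ Measurable w ∧ Integrable (fun x => w x ^ 2 * u x) ∧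
      (∀ x, u x ≤ B) ∧ (∀ x, u x ≠ 0 → x ∈ Set.Icc (z - r) (z + r)) := by
  set g : ℝ → ℝ := fun x => max 0 (r ^ 2 - (x - z) ^ 2) with hg
  have hgc : Continuous g := by fun_prop
  have hsupp : ∀ x, g x ≠ 0 → x ∈ Set.Icc (z - r) (z + r) := by
    intro x hx
    have : ¬ (r ^ 2 - (x - z) ^ 2 ≤ 0) := fun h => hx (max_eq_left h)
    have := abs_lt_of_sq_lt_sq' (by linarith : (x - z) ^ 2 < r ^ 2) hr.le
    constructor <;> linarith [this.1, this.2]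
  have hg0 : ∀ x, 0 ≤ g x := fun x => le_max_left _ _
  have hgr : ∀ x, g x ≤ r ^ 2 := fun x => max_le (by positivity) (by nlinarith [sq_nonneg (x - z)])
  have hcs : HasCompactSupport fun x => g x ^ 2 := by
    refine HasCompactSupport.of_support_subset_isCompact (isCompact_Icc (a := z - r) (b := z + r)) ?_
    intro x hx
    exact hsupp x fun h => hx (by simp [h])
  have hc2 : Continuous fun x => g x ^ 2 := hgc.pow 2
  have hpos : 0 < ∫ x, g x ^ 2 := by
    refine hc2.integral_pos_of_hasCompactSupport_nonneg_nonzero hcs (fun x => sq_nonneg _) (x := z) ?_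
    have hgz : g z = r ^ 2 := by simp [hg, sq_nonneg r]
    rw [hgz]
    positivity
  set c := (∫ x, g x ^ 2)⁻¹ with hcdef
  have hcpos : 0 < c := inv_pos.2 hpos
  -- Squaring the truncated parabola makes the density differentiable at the edges. On the support
  -- `w ^ 2 * u` is `16 * (x - z) ^ 2 * c`, hence bounded; off it, division by zero makes `w`
  -- vanish, in accordance with the zero derivative there.
  refine ⟨fun x => c * g x ^ 2, fun x => 4 * (x - z) / g x, c * (r ^ 2) ^ 2, ?_, ?_, ?_, ?_, ?_, ?_,
    ?_, ?_⟩
  · exact fun x => by positivity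
  · exact (hc2.integrable_of_hasCompactSupport hcs).const_mul c
  · rw [integral_const_mul, hcdef, inv_mul_cancel₀ hpos.ne']
  · intro x
    have h1 : HasDerivAt (fun x : ℝ => r ^ 2 - (x - z) ^ 2) (-(2 * (x - z))) x := by
      simpa using (((hasDerivAt_id x).sub_const z).pow 2).const_sub (r ^ 2)
    have h2 := ((hasDerivAt_max_zero_sq _).comp x h1).const_mul c
    refine h2.congr_deriv ?_
    change c * (2 * g x * -(2 * (x - z))) = _
    by_cases h0 : g x = 0
    · simp [h0]
    · field_simp
      ring
  · exact Measurable.div (by fun_prop) hgc.measurable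
  · have hi : Integrable ((Set.Icc (z - r) (z + r)).indicator fun _ => 16 * r ^ 2 * c) :=
      (integrable_indicator_iff measurableSet_Icc).2 (integrableOn_const (by simp))
    refine hi.mono' ?_ (Eventually.of_forall fun x => ?_)
    · exact ((Measurable.div (by fun_prop) hgc.measurable).pow_const 2 |>.mul
        (hc2.measurable.const_mul c)).aestronglyMeasurable
    · by_cases h0 : g x = 0
      · simp only [h0]
        simp only [div_zero, ne_eq, OfNat.ofNat_ne_zero, not_false_eq_true, zero_pow, mul_zero,
          norm_zero]
        exact Set.indicator_nonneg (fun _ _ => by positivity) _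
      · have hx := hsupp x h0
        rw [Set.indicator_of_mem hx]
        have : (4 * (x - z) / g x) ^ 2 * (c * g x ^ 2) = 16 * (x - z) ^ 2 * c := by
          field_simp
          ring
        rw [this, Real.norm_eq_abs, abs_of_nonneg (by positivity)]
        have : (x - z) ^ 2 ≤ r ^ 2 := by
          apply sq_le_sq'
          · linarith [hx.1]
          · linarith [hx.2]
        nlinarith
  · intro x
    exact mul_le_mul_of_nonneg_left (pow_le_pow_left₀ (hg0 x) (hgr x) 2) hcpos.le
  · intro x hx
    exact hsupp x fun h => hx (by simp [h])

/-- The indicator function of a measurable set. -/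
noncomputable def BddMeas.ofSet (K : Set ℝ) (hK : MeasurableSet K) : BddMeas :=
  ⟨K.indicator fun _ => 1, measurable_const.indicator hK, 1, fun x => by
    by_cases h : x ∈ K <;> simp [h]⟩

/-- The convolution square of the uniform measure on `K` has a continuous density. -/
lemma exists_continuous_density_conv_restrict {K : Set ℝ} (hK : MeasurableSet K)
    (hfin : volume K ≠ ∞) :
    ∃ q : ℝ → ℝ, Continuous q ∧
      (volume.restrict K : Measure ℝ) ∗ volume.restrict K
        = volume.withDensity fun z => ENNReal.ofReal (q z) := by
  have hfm : IsFiniteMeasure (volume.restrict K : Measure ℝ) := ⟨by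
    rw [Measure.restrict_apply_univ]; exact hfin.lt_top⟩
  set f := BddMeas.ofSet K hK with hf
  have hfi : Integrable fun y => f y :=
    (integrable_indicator_iff hK).2 (integrableOn_const hfin)
  have hf0 : ∀ x, 0 ≤ f x := fun x => Set.indicator_nonneg (fun _ _ => zero_le_one) _
  have hfind : ∀ x, ENNReal.ofReal (f x) = K.indicator 1 x := by
    intro x
    by_cases h : x ∈ K <;> simp [hf, BddMeas.ofSet, h]
  have hv : Integrable fun y => f (-y) := hfi.comp_neg
  -- The density at `z` is the volume of K ∩ (z - K). It is continuous even if `K` has empty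
  -- interior, which is why two summands are convolved.
  refine ⟨_, continuous_integral_bddMeas_mul f hv, ?_⟩
  refine Measure.ext_of_lintegral _ fun F hF => ?_
  rw [Measure.lintegral_conv hF, lintegral_withDensity_eq_lintegral_mul _
    (continuous_integral_bddMeas_mul f hv).measurable.ennreal_ofReal hF]
  have hfm := f.measurable
  have h1 : ∀ z, ENNReal.ofReal (∫ y, f (z + y) * f (-y))
      = ∫⁻ x, K.indicator 1 x * K.indicator 1 (z - x) := by
    intro z
    have e : ∫ y, f (z + y) * f (-y) = ∫ x, f (z - x) * f x := by
      rw [← integral_neg_eq_self (fun y => f (z + y) * f (-y))]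
      simp [sub_eq_add_neg]
    rw [e, ofReal_integral_eq_lintegral_ofReal]
    · refine lintegral_congr fun x => ?_
      rw [ENNReal.ofReal_mul (hf0 _), hfind, hfind, mul_comm]
    · exact f.integrable_mul hfi (by fun_prop)
    · exact Eventually.of_forall fun x => mul_nonneg (hf0 _) (hf0 _)
  have hKm : Measurable (K.indicator (1 : ℝ → ℝ≥0∞)) := measurable_one.indicator hK
  have hswap : ∀ x, ∫⁻ y, K.indicator 1 y * F (x + y)
      = ∫⁻ z, K.indicator 1 (z - x) * F z := by
    intro x
    rw [← lintegral_sub_right_eq_self (fun y => K.indicator 1 y * F (x + y)) x]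
    simp
  have hrestr : ∀ G : ℝ → ℝ≥0∞, ∫⁻ x in K, G x = ∫⁻ x, K.indicator 1 x * G x := by
    intro G
    rw [← lintegral_indicator hK]
    refine lintegral_congr fun x => ?_
    by_cases h : x ∈ K <;> simp [h]
  simp only [hrestr, hswap, Pi.mul_apply, h1]
  have hm1 : Measurable fun p : ℝ × ℝ => K.indicator (1 : ℝ → ℝ≥0∞) (p.2 - p.1) * F p.2 :=
    (hKm.comp (measurable_snd.sub measurable_fst)).mul (hF.comp measurable_snd)
  have hm2 : Measurable fun p : ℝ × ℝ => K.indicator (1 : ℝ → ℝ≥0∞) p.1 *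
      (K.indicator (1 : ℝ → ℝ≥0∞) (p.2 - p.1) * F p.2) := (hKm.comp measurable_fst).mul hm1
  calc ∫⁻ x, K.indicator 1 x * ∫⁻ z, K.indicator 1 (z - x) * F z
      = ∫⁻ x, ∫⁻ z, K.indicator 1 x * (K.indicator 1 (z - x) * F z) := by
        refine lintegral_congr fun x => ?_
        rw [lintegral_const_mul]
        exact (hKm.comp (measurable_id.sub_const x)).mul hF
    _ = ∫⁻ z, ∫⁻ x, K.indicator 1 x * (K.indicator 1 (z - x) * F z) :=
        lintegral_lintegral_swap hm2.aemeasurable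
    _ = _ := by
        refine lintegral_congr fun z => ?_
        rw [← lintegral_mul_const]
        · simp only [mul_assoc]
        · exact hKm.mul (hKm.comp (measurable_const.sub measurable_id))

/-- Only the lower bound of the density is kept: Lebesgue measure on `K` scaled by `p * c`. If `K`
were null, the probability law `F₁` would be zero. -/
lemma HasContinuousComponent.exists_smul_restrict_le {μ : Measure ℝ}
    (h : HasContinuousComponent μ) :
    ∃ (K : Set ℝ) (κ : ℝ≥0), MeasurableSet K ∧ volume K ≠ ∞ ∧ volume K ≠ 0 ∧ 0 < κ ∧
      κ • (volume.restrict K : Measure ℝ) ≤ μ := by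
  obtain ⟨p, q, F₁, F₂, hp, -, hF₁, -, ⟨f, K, c, hf, hK, hc, hfc, hf0, rfl⟩, rfl⟩ := h
  refine ⟨K, p * c.toNNReal, hK.measurableSet, hK.measure_lt_top.ne, ?_,
    mul_pos hp (Real.toNNReal_pos.2 hc), ?_⟩
  · intro h0
    have h1 := measure_univ (μ := volume.withDensity fun x => ENNReal.ofReal (f x))
    rw [withDensity_apply _ MeasurableSet.univ, Measure.restrict_univ,
      lintegral_eq_zero_of_ae_eq_zero] at h1
    · exact zero_ne_one h1
    · filter_upwards [measure_eq_zero_iff_ae_notMem.1 h0] with x hx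
      simp [hf0 x hx]
  · refine Measure.le_iff.2 fun s hs => ?_
    simp only [Measure.add_apply, Measure.smul_apply, Measure.nnreal_smul_coe_apply]
    refine le_add_right ?_
    rw [ENNReal.coe_mul, mul_assoc]
    gcongr
    rw [withDensity_apply _ hs, Measure.restrict_apply hs]
    calc (c.toNNReal : ℝ≥0∞) * volume (s ∩ K) = ∫⁻ _ in s ∩ K, (c.toNNReal : ℝ≥0∞) := by
          rw [setLIntegral_const]
      _ ≤ ∫⁻ x in s ∩ K, ENNReal.ofReal (f x) := by
          refine setLIntegral_mono (by fun_prop) fun x hx => ?_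
          exact ENNReal.ofReal_le_ofReal (hfc x hx.2)
      _ ≤ _ := lintegral_mono_set Set.inter_subset_left

lemma smul_conv_smul_le {μ ρ : Measure ℝ} [SFinite μ] [SFinite ρ] {κ : ℝ≥0} (h : κ • ρ ≤ μ) :
    (κ * κ) • (ρ ∗ ρ) ≤ μ ∗ μ := by
  refine Measure.le_iff.2 fun s hs => ?_
  have hm : Measurable (s.indicator (1 : ℝ → ℝ≥0∞)) := measurable_one.indicator hs
  rw [← lintegral_indicator_one hs, ← lintegral_indicator_one hs, lintegral_smul_measure,
    Measure.lintegral_conv hm, Measure.lintegral_conv hm]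
  calc (κ * κ) • ∫⁻ x, ∫⁻ y, s.indicator (1 : ℝ → ℝ≥0∞) (x + y) ∂ρ ∂ρ
      = ∫⁻ x, ∫⁻ y, s.indicator (1 : ℝ → ℝ≥0∞) (x + y) ∂(κ • ρ) ∂(κ • ρ) := by
        simp only [lintegral_smul_measure, ENNReal.smul_def, smul_eq_mul]
        rw [lintegral_const_mul, ENNReal.coe_mul, mul_assoc]
        exact (hm.comp (measurable_fst.add measurable_snd)).lintegral_prod_right'
    _ ≤ ∫⁻ x, ∫⁻ y, s.indicator (1 : ℝ → ℝ≥0∞) (x + y) ∂μ ∂μ :=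
        lintegral_mono' h fun x => lintegral_mono' h fun y => le_rfl

/-- The convolution square of a law with a continuous component has a smooth component. -/
lemma HasContinuousComponent.exists_smooth_component {μ : Measure ℝ} [IsProbabilityMeasure μ]
    (h : HasContinuousComponent μ) :
    ∃ (β : ℝ≥0) (U R : Measure ℝ) (I : ℝ) (_ : IsProbabilityMeasure U) (_ : IsFiniteMeasure R),
      0 < β ∧ β ≤ 1 ∧ μ ∗ μ = β • U + R ∧ R.real Set.univ = 1 - β ∧ 0 ≤ I ∧
      ∀ k : ℕ, 1 ≤ k → SmoothBy ((convOp U) ^ k) (I / √k) := by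
  obtain ⟨K, κ, hK, hfin, hne, hκ, hle⟩ := h.exists_smul_restrict_le
  obtain ⟨q, hq, hconv⟩ := exists_continuous_density_conv_restrict hK hfin
  -- Otherwise the convolution square would vanish, while its mass is the square of the volume of
  -- `K`.
  obtain ⟨z, hz⟩ : ∃ z, 0 < q z := by
    by_contra! hcon
    have h1 : ((volume.restrict K : Measure ℝ) ∗ volume.restrict K) Set.univ = 0 := by
      rw [hconv, withDensity_apply _ MeasurableSet.univ]
      simp [ENNReal.ofReal_of_nonpos (hcon _)]
    have : IsFiniteMeasure (volume.restrict K : Measure ℝ) := ⟨by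
      rw [Measure.restrict_apply_univ]; exact hfin.lt_top⟩
    rw [Measure.conv, Measure.map_apply (by fun_prop) MeasurableSet.univ, Set.preimage_univ,
      ← Set.univ_prod_univ, Measure.prod_prod] at h1
    simp [hne] at h1
  obtain ⟨r, hr, hball⟩ := Metric.eventually_nhds_iff_ball.1
    (hq.continuousAt.eventually (lt_mem_nhds (half_lt_self hz)))
  obtain ⟨u, w, B, hu0, hu, hu1, hd, hw, hw2, hB, hsupp⟩ :=
    exists_density_finite_fisher z (r / 2) (half_pos hr)
  have hum : Measurable u := by
    have hc : Continuous u := continuous_iff_continuousAt.2 fun x => (hd x).continuousAt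
    exact hc.measurable
  set U : Measure ℝ := volume.withDensity fun x => ENNReal.ofReal (u x) with hU
  have hUp : IsProbabilityMeasure U := ⟨by
    rw [hU, withDensity_apply _ MeasurableSet.univ, Measure.restrict_univ,
      ← ofReal_integral_eq_lintegral_ofReal hu (Eventually.of_forall hu0), hu1]
    simp⟩
  have hBpos : 0 < B := by
    by_contra! hcon
    have : u = fun _ => 0 := funext fun x => le_antisymm ((hB x).trans hcon) (hu0 x)
    simp [this] at hu1
  -- Since `u ≤ B`, this makes `δ * u` at most `q z / 2`, which is below `q` on the ball containing
  -- the support of `u`.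
  set δ : ℝ≥0 := (q z / 2 / B).toNNReal with hδ
  have hδpos : 0 < δ := Real.toNNReal_pos.2 (by positivity)
  have hle2 : δ • U ≤ volume.withDensity fun z => ENNReal.ofReal (q z) := by
    have : δ • U = volume.withDensity fun x => ENNReal.ofReal (q z / 2 / B * u x) := by
      have e : (fun x => ENNReal.ofReal (q z / 2 / B * u x))
          = (δ : ℝ≥0∞) • fun x => ENNReal.ofReal (u x) := by
        ext x
        rw [ENNReal.ofReal_mul (by positivity)]
        rfl
      rw [e, withDensity_smul _ (by fun_prop)]
      rfl
    rw [this]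
    refine withDensity_mono (Eventually.of_forall fun x => ?_)
    by_cases hx : u x = 0
    · simp [hx]
    · have hxm := hsupp x hx
      have hxb : x ∈ Metric.ball z r := by
        rw [Metric.mem_ball, Real.dist_eq, abs_lt]
        constructor <;> linarith [hxm.1, hxm.2]
      refine ENNReal.ofReal_le_ofReal (le_trans ?_ (hball x hxb).le)
      rw [div_mul_eq_mul_div, div_le_iff₀ hBpos]
      exact mul_le_mul_of_nonneg_left (hB x) (by positivity)
  set β : ℝ≥0 := κ * κ * δ with hβ
  have hle3 : β • U ≤ μ ∗ μ := by
    refine le_trans ?_ (smul_conv_smul_le hle)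
    rw [hconv, hβ, mul_smul]
    refine Measure.le_iff.2 fun s _ => ?_
    simp only [Measure.smul_apply]
    exact smul_le_smul_of_nonneg_left (hle2 s) zero_le
  have hβ1 : β ≤ 1 := by
    have := hle3 Set.univ
    simpa using this
  have hfin : IsFiniteMeasure (μ ∗ μ - β • U) :=
    isFiniteMeasure_of_le _ Measure.sub_le
  have hdec : μ ∗ μ = β • U + (μ ∗ μ - β • U) := by
    rw [add_comm, Measure.sub_add_cancel_of_le hle3]
  refine ⟨β, U, μ ∗ μ - β • U, √(∫ x, w x ^ 2 * u x), hUp, hfin, by positivity, hβ1, hdec, ?_,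
    Real.sqrt_nonneg _, fun k hk => smoothBy_convOp_pow hU hu0 hu hd hw hw2 hk⟩
  have h1 : (μ ∗ μ).real Set.univ = (β • U).real Set.univ + (μ ∗ μ - β • U).real Set.univ := by
    rw [← measureReal_add_apply, ← hdec]
  simp at h1
  linarith

/-! ### Taylor expansion of convolution operators -/

/-- The mean value inequality suffices. The factor `1 / (n + 1)` that integration would give is
dropped, so the Taylor remainder below carries no factorial. -/
lemma abs_le_mul_pow_succ_of_deriv {G G' : ℝ → ℝ} (hG : ∀ y, HasDerivAt G (G' y) y)
    (h0 : G 0 = 0) {C : ℝ} (hC : 0 ≤ C) {n : ℕ} (h : ∀ y, |G' y| ≤ C * |y| ^ n) (y : ℝ) :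
    |G y| ≤ C * |y| ^ (n + 1) := by
  have hb : ∀ t ∈ Set.uIcc 0 y, ‖G' t‖ ≤ C * |y| ^ n := by
    intro t ht
    have : |t| ≤ |y| := by simpa using Set.abs_sub_left_of_mem_uIcc ht
    exact (h t).trans (mul_le_mul_of_nonneg_left (pow_le_pow_left₀ (abs_nonneg _) this n) hC)
  have := Convex.norm_image_sub_le_of_norm_hasDerivWithin_le (s := Set.uIcc 0 y)
    (fun t _ => (hG t).hasDerivWithinAt) hb (convex_uIcc 0 y) Set.left_mem_uIcc Set.right_mem_uIcc
  simpa [h0, pow_succ, mul_assoc] using this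

/-- Taylor's formula for a chain of derivatives. -/
lemma abs_taylor_remainder_le {n : ℕ} {g : ℕ → BddMeas} {M : ℝ}
    (hg : ∀ k < n, IsDeriv (g k) (g (k + 1))) (hM : (g n).BoundedBy M) (x y : ℝ) :
    |g 0 (x + y) - ∑ j ∈ Finset.range n, g j x * (y ^ j / j.factorial)| ≤ M * |y| ^ n := by
  induction n generalizing g y with
  | zero => simpa using hM _
  | succ n ih =>
    -- Differentiating the remainder in `y` gives the remainder of one order less for the shifted
    -- chain.
    refine abs_le_mul_pow_succ_of_deriv (G := fun y => g 0 (x + y)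
        - ∑ j ∈ Finset.range (n + 1), g j x * (y ^ j / j.factorial))
      (G' := fun y => g 1 (x + y) - ∑ j ∈ Finset.range n, g (j + 1) x * (y ^ j / j.factorial))
      (fun y => ?_) ?_ hM.nonneg
      (fun y => ih (g := fun k => g (k + 1)) (fun k hk => hg (k + 1) (by omega)) hM y) y
    · refine HasDerivAt.sub ((hg 0 (by omega) (x + y)).comp_const_add x y) ?_
      simp only [Finset.sum_range_succ', Nat.factorial_zero, pow_zero]
      refine HasDerivAt.add_const _ ?_
      refine HasDerivAt.fun_sum fun j _ => HasDerivAt.const_mul _ ?_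
      refine ((hasDerivAt_pow (j + 1) y).div_const _).congr_deriv ?_
      rw [Nat.factorial_succ]
      have : (j.factorial : ℝ) ≠ 0 := by positivity
      push_cast
      field_simp
    · simp [Finset.sum_range_succ']

lemma integrable_pow_of_integrable_abs_pow {ρ : Measure ℝ} [IsFiniteMeasure ρ] {n j : ℕ}
    (hn : Integrable (fun y => |y| ^ n) ρ) (hj : j ≤ n) : Integrable (fun y => y ^ j) ρ := by
  refine ((integrable_const (1 : ℝ)).add hn).mono' (by fun_prop) (Eventually.of_forall fun y => ?_)
  rw [norm_pow, Real.norm_eq_abs, Pi.add_apply]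
  rcases le_total |y| 1 with h | h
  · have := pow_le_one₀ (n := j) (abs_nonneg y) h
    have := pow_nonneg (abs_nonneg y) n
    linarith
  · have := pow_le_pow_right₀ h hj
    linarith

/-- The Taylor expansion of an average over small translations. -/
lemma abs_convOp_sub_taylor_le {ρ : Measure ℝ} [IsFiniteMeasure ρ] {n : ℕ}
    (hn : Integrable (fun y => |y| ^ n) ρ) {g : ℕ → BddMeas} {M : ℝ}
    (hg : ∀ k < n, IsDeriv (g k) (g (k + 1))) (hM : (g n).BoundedBy M) (x : ℝ) :
    |convOp ρ (g 0) x - ∑ j ∈ Finset.range n, g j x * ((∫ y, y ^ j ∂ρ) / j.factorial)|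
      ≤ M * ∫ y, |y| ^ n ∂ρ := by
  have hi : ∀ j ∈ Finset.range n, Integrable (fun y => g j x * (y ^ j / j.factorial)) ρ :=
    fun j hj => ((integrable_pow_of_integrable_abs_pow hn
      (Finset.mem_range.1 hj).le).div_const _).const_mul _
  have h1 : ∑ j ∈ Finset.range n, g j x * ((∫ y, y ^ j ∂ρ) / j.factorial)
      = ∫ y, ∑ j ∈ Finset.range n, g j x * (y ^ j / j.factorial) ∂ρ := by
    rw [integral_finsetSum _ hi]
    refine Finset.sum_congr rfl fun j _ => ?_
    rw [integral_const_mul, integral_div]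
  rw [h1, convOp_apply, ← integral_sub ((g 0).integrable_comp (by fun_prop))
    (integrable_finsetSum _ hi), ← integral_const_mul, ← Real.norm_eq_abs]
  exact norm_integral_le_of_norm_le (hn.const_mul M)
    (Eventually.of_forall fun y => abs_taylor_remainder_le hg hM x y)

/-- The difference of two laws with matching moments acts as a differential operator. -/
lemma opBound_convOp_sub_mul_pow {μ ν : Measure ℝ} [IsFiniteMeasure μ] [IsFiniteMeasure ν] {n : ℕ}
    (hμ : Integrable (fun y => |y| ^ n) μ) (hν : Integrable (fun y => |y| ^ n) ν)
    (hmom : ∀ j < n, ∫ y, y ^ j ∂μ = ∫ y, y ^ j ∂ν) {A : Module.End ℝ BddMeas} {e : ℝ}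
    (hA : SmoothBy A e) (hP : PreservesDeriv A) :
    OpBound ((convOp μ - convOp ν) * A ^ n) (e ^ n * (∫ y, |y| ^ n ∂μ + ∫ y, |y| ^ n ∂ν)) := by
  intro f M hf x
  obtain ⟨g, hg0, hg, hgn⟩ := hA.exists_derivs hP n f M hf
  have h1 := abs_convOp_sub_taylor_le hμ hg hgn x
  have h2 := abs_convOp_sub_taylor_le hν hg hgn x
  -- With equal moments the two Taylor polynomials coincide, so only the remainders survive in the
  -- difference.
  rw [Finset.sum_congr rfl fun j hj => by rw [hmom j (Finset.mem_range.1 hj)]] at h1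
  change |convOp μ ((A ^ n) f) x - convOp ν ((A ^ n) f) x| ≤ _
  rw [← hg0]
  rw [abs_le] at *
  constructor <;> nlinarith [h1.1, h1.2, h2.1, h2.2]

/-! ### Binomial averages and smoothing powers -/

/-- This bounds E[1/(B+1); B ≥ 1] for B binomial (m, β), with B = k + 1. Absorbing the denominator
into the binomial coefficient turns the sum into a part of the expansion of (β + (1 - β))^(m+1). -/
lemma sum_binomial_div_succ_le {β : ℝ} (h0 : 0 < β) (h1 : β ≤ 1) (m : ℕ) :
    ∑ k ∈ Finset.range m, β ^ (k + 1) * (m.choose (k + 1)) * (1 - β) ^ (m - (k + 1))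
      / ((k : ℝ) + 2) ≤ 1 / ((m + 1) * β) := by
  have hq : 0 ≤ 1 - β := by linarith
  have hb := add_pow β (1 - β) (m + 1)
  rw [add_sub_cancel, one_pow, Finset.sum_range_succ', Finset.sum_range_succ'] at hb
  rw [le_div_iff₀ (by positivity), Finset.sum_mul]
  have : ∑ k ∈ Finset.range m, β ^ (k + 1) * (m.choose (k + 1)) * (1 - β) ^ (m - (k + 1))
      / ((k : ℝ) + 2) * ((m + 1) * β)
      = ∑ k ∈ Finset.range m, β ^ (k + 1 + 1) * (1 - β) ^ (m + 1 - (k + 1 + 1))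
        * ((m + 1).choose (k + 1 + 1)) := by
    refine Finset.sum_congr rfl fun k _ => ?_
    have hc : ((m : ℝ) + 1) * m.choose (k + 1) = (m + 1).choose (k + 1 + 1) * ((k : ℝ) + 2) := by
      have := Nat.add_one_mul_choose_eq m (k + 1)
      rw [← Nat.cast_add_one, ← Nat.cast_mul, this]
      push_cast
      ring
    have hk : ((k : ℝ) + 2) ≠ 0 := by positivity
    rw [Nat.add_sub_add_right m 1 (k + 1), div_mul_eq_mul_div, div_eq_iff hk]
    linear_combination β ^ (k + 1) * (1 - β) ^ (m - (k + 1)) * β * hc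
  rw [this]
  refine le_trans ?_ hb.ge
  rw [add_assoc]
  refine le_add_of_nonneg_right ?_
  positivity

/-- The inequality 1/√B ≤ t/(B+1) + 1/t, of AM–GM type, reduces the inverse square root to the
previous mean; t = √(m+1) balances the two terms. -/
lemma sum_binomial_div_sqrt_le {β : ℝ} (h0 : 0 < β) (h1 : β ≤ 1) (m : ℕ) :
    ∑ k ∈ Finset.range m, β ^ (k + 1) * (m.choose (k + 1)) * (1 - β) ^ (m - (k + 1))
      / √((k : ℝ) + 1) ≤ 2 / β / √((m : ℝ) + 1) := by
  have hq : 0 ≤ 1 - β := by linarith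
  set t := √((m : ℝ) + 1) with ht
  have htpos : 0 < t := Real.sqrt_pos.2 (by positivity)
  have htt : t * t = m + 1 := Real.mul_self_sqrt (by positivity)
  have hk : ∀ k : ℕ, 1 / √((k : ℝ) + 1) ≤ t * (1 / ((k : ℝ) + 2)) + 1 / t := by
    intro k
    set s := √((k : ℝ) + 1) with hs
    have hspos : 0 < s := Real.sqrt_pos.2 (by positivity)
    have hss : s * s = k + 1 := Real.mul_self_sqrt (by positivity)
    have e : (k : ℝ) + 2 = s * s + 1 := by linarith
    have hs1 : 1 ≤ s * s := by rw [hss]; linarith [(Nat.cast_nonneg k : (0 : ℝ) ≤ k)]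
    rw [e, mul_one_div, div_add_div _ _ (by positivity) htpos.ne', div_le_div_iff₀ hspos
      (by positivity)]
    nlinarith [sq_nonneg (t - s), mul_pos htpos hspos, sq_nonneg (s * t - s * s),
      mul_nonneg (sub_nonneg.2 hs1) hspos.le, mul_nonneg hspos.le (sq_nonneg (t - s))]
  have hw : ∑ k ∈ Finset.range m, β ^ (k + 1) * (m.choose (k + 1)) * (1 - β) ^ (m - (k + 1))
      ≤ 1 := by
    have hb := add_pow β (1 - β) m
    rw [add_sub_cancel, one_pow, Finset.sum_range_succ'] at hb
    refine le_trans ?_ hb.ge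
    refine le_add_of_le_of_nonneg (le_of_eq (Finset.sum_congr rfl fun k _ => by ring)) ?_
    positivity
  calc _ ≤ ∑ k ∈ Finset.range m, (t * (β ^ (k + 1) * (m.choose (k + 1)) * (1 - β) ^ (m - (k + 1))
      / ((k : ℝ) + 2)) + β ^ (k + 1) * (m.choose (k + 1)) * (1 - β) ^ (m - (k + 1)) * (1 / t)) := by
        refine Finset.sum_le_sum fun k _ => ?_
        have hn : 0 ≤ β ^ (k + 1) * (m.choose (k + 1)) * (1 - β) ^ (m - (k + 1)) := by positivity
        refine le_trans (le_of_eq (div_eq_mul_one_div _ _))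
          ((mul_le_mul_of_nonneg_left (hk k) hn).trans (le_of_eq ?_))
        ring
    _ = t * ∑ k ∈ Finset.range m, β ^ (k + 1) * (m.choose (k + 1)) * (1 - β) ^ (m - (k + 1))
      / ((k : ℝ) + 2) + (∑ k ∈ Finset.range m, β ^ (k + 1) * (m.choose (k + 1))
        * (1 - β) ^ (m - (k + 1))) * (1 / t) := by
        rw [Finset.sum_add_distrib, Finset.mul_sum, Finset.sum_mul]
    _ ≤ t * (1 / ((m + 1) * β)) + 1 * (1 / t) := by
        gcongr
        exact sum_binomial_div_succ_le h0 h1 m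
    _ = (1 / β + 1) / t := by
        rw [← htt]; field_simp
    _ ≤ _ := by
        gcongr
        rw [div_add_one h0.ne']
        gcongr
        linarith

/-- The binomial expansion of a power, all terms of which but one are smooth. -/
lemma smoothBy_add_pow_sub_pow {u ρ : Module.End ℝ BddMeas} {β I : ℝ} (h0 : 0 < β) (h1 : β ≤ 1)
    (hI : 0 ≤ I) (hcomm : Commute u ρ) (hρ : OpBound ρ (1 - β))
    (hs : ∀ k : ℕ, 1 ≤ k → SmoothBy (u ^ k) (I / √k)) (m : ℕ) :
    SmoothBy ((β • u + ρ) ^ m - ρ ^ m) (2 * I / β / √((m : ℝ) + 1)) := by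
  rw [(hcomm.smul_left β).add_pow, Finset.sum_range_succ']
  simp only [pow_zero, one_mul, Nat.sub_zero, Nat.choose_zero_right, Nat.cast_one, mul_one,
    add_sub_cancel_right]
  have hterm : ∀ k ∈ Finset.range m, SmoothBy ((β • u) ^ (k + 1) * ρ ^ (m - (k + 1))
      * (m.choose (k + 1))) (I * (β ^ (k + 1) * (m.choose (k + 1)) * (1 - β) ^ (m - (k + 1))
      / √((k : ℝ) + 1))) := by
    intro k _
    have e : (β • u) ^ (k + 1) * ρ ^ (m - (k + 1)) * ((m.choose (k + 1) : ℕ) : Module.End ℝ BddMeas)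
        = (β ^ (k + 1) * (m.choose (k + 1))) • (u ^ (k + 1) * ρ ^ (m - (k + 1))) := by
      rw [smul_pow, smul_mul_assoc, mul_smul, ← Nat.cast_comm, ← nsmul_eq_mul,
        ← Nat.cast_smul_eq_nsmul ℝ, smul_comm]
    rw [e]
    refine (((hs (k + 1) (by omega)).mul_right (hρ.pow _)).smul _).mono (le_of_eq ?_)
    rw [abs_of_nonneg (by positivity)]
    push_cast
    ring
  refine (SmoothBy.sum _ hterm).mono ?_
  rw [← Finset.mul_sum]
  refine (mul_le_mul_of_nonneg_left (sum_binomial_div_sqrt_le h0 h1 m) hI).trans (le_of_eq ?_)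
  ring

/-- The powers of `a` are smoothing of the natural order, up to a small error. -/
def SmoothingPowers (a : Module.End ℝ BddMeas) : Prop :=
  ∃ E : ℝ, 0 ≤ E ∧ ∀ q : ℕ, ∃ A : Module.End ℝ BddMeas, PreservesDeriv A ∧ OpBound A 2 ∧
    SmoothBy A (E / √((q : ℝ) + 1)) ∧ OpBound (a ^ (2 * q) - A) (E / √((q : ℝ) + 1) ^ 3)

/-- Geometric decay beats the order -3/2 allowed to the error in `SmoothingPowers`. -/
lemma exists_pow_le_div_sqrt_pow {r : ℝ} (h0 : 0 ≤ r) (h1 : r < 1) :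
    ∃ E : ℝ, 0 ≤ E ∧ ∀ m : ℕ, r ^ m ≤ E / √((m : ℝ) + 1) ^ 3 := by
  have ht := tendsto_pow_const_mul_const_pow_of_abs_lt_one 2 (by rwa [abs_of_nonneg h0])
  obtain ⟨B, hB⟩ := ht.bddAbove_range
  have hB' : ∀ m : ℕ, (m : ℝ) ^ 2 * r ^ m ≤ B := fun m => hB ⟨m, rfl⟩
  have hB0 : 0 ≤ B := by simpa using hB' 0
  refine ⟨1 + 4 * B, by positivity, fun m => ?_⟩
  set s := √((m : ℝ) + 1) with hs
  have hs1 : 1 ≤ s := Real.one_le_sqrt.2 (by linarith [(Nat.cast_nonneg m : (0 : ℝ) ≤ m)])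
  have hss : s ^ 2 = m + 1 := Real.sq_sqrt (by positivity)
  rw [le_div_iff₀ (by positivity)]
  have h3 : s ^ 3 ≤ ((m : ℝ) + 1) ^ 2 := by
    rw [← hss, ← pow_mul]
    exact pow_le_pow_right₀ hs1 (by norm_num)
  refine (mul_le_mul_of_nonneg_left h3 (by positivity)).trans ?_
  rcases Nat.eq_zero_or_pos m with rfl | hm
  · simp; linarith
  · have hm1 : (1 : ℝ) ≤ m := by exact_mod_cast hm
    have : ((m : ℝ) + 1) ^ 2 ≤ 4 * m ^ 2 := by nlinarith
    calc r ^ m * ((m : ℝ) + 1) ^ 2 ≤ r ^ m * (4 * m ^ 2) := by gcongr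
      _ = 4 * (m ^ 2 * r ^ m) := by ring
      _ ≤ _ := by linarith [hB' m]

/-- Exponents are even because the smooth component is found in `μ ∗ μ`. The operator `A` is the
power without its term free of `U`; that term has norm at most (1 - β)^q. -/
lemma HasContinuousComponent.smoothingPowers {μ : Measure ℝ} [IsProbabilityMeasure μ]
    (h : HasContinuousComponent μ) : SmoothingPowers (convOp μ) := by
  obtain ⟨β, U, R, I, hU, hR, hβ0, hβ1, hdec, hmass, hI, hs⟩ := h.exists_smooth_component
  have h0 : (0 : ℝ) < β := hβ0
  have h1 : (β : ℝ) ≤ 1 := hβ1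
  have hsq : convOp μ ^ 2 = (β : ℝ) • convOp U + convOp R := by
    have h2 : convOp (μ ∗ μ) = convOp (β • U + R) := by simp only [hdec]
    rw [sq, convOp_mul, h2, convOp_add, convOp_smul]
  have hRb : OpBound (convOp R) (1 - β) := hmass ▸ opBound_convOp R
  obtain ⟨E, hE, hpow⟩ := exists_pow_le_div_sqrt_pow (r := 1 - β) (by linarith) (by linarith)
  refine ⟨max (2 * I / β) E, le_max_of_le_right hE, fun q =>
    ⟨((β : ℝ) • convOp U + convOp R) ^ q - convOp R ^ q, ?_, ?_, ?_, ?_⟩⟩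
  · rw [sub_eq_add_neg, ← neg_one_smul ℝ]
    exact ((((PreservesDeriv.convOp U).smul β).add (.convOp R)).pow q).add
      (((PreservesDeriv.convOp R).pow q).smul _)
  · rw [← hsq, ← pow_mul]
    refine (((opBound_convOp_one μ).pow_one _).sub (hRb.pow q)).mono ?_
    have := pow_le_one₀ (n := q) (by linarith : (0 : ℝ) ≤ 1 - β) (by linarith)
    linarith
  · refine (smoothBy_add_pow_sub_pow h0 h1 hI (convOp_commute U R) hRb hs q).mono ?_
    gcongr
    exact le_max_left _ _
  · rw [pow_mul, hsq, sub_sub_cancel]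
    refine (hRb.pow q).mono ((hpow q).trans ?_)
    gcongr
    exact le_max_right _ _

lemma smoothingPowers_of_smoothBy {b : Module.End ℝ BddMeas} (hb : OpBound b 1)
    (hP : PreservesDeriv b) (hs : ∀ k : ℕ, 1 ≤ k → SmoothBy (b ^ k) (1 / √k)) :
    SmoothingPowers b := by
  refine ⟨1, zero_le_one, fun q => ?_⟩
  rcases Nat.eq_zero_or_pos q with rfl | hq
  -- The power `b ^ 0` is the identity, which does not smooth, so it is counted wholly as error.
  · refine ⟨0, PreservesDeriv.zero, OpBound.zero.mono (by norm_num), SmoothBy.zero.mono ?_, ?_⟩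
    · positivity
    · simpa using OpBound.one
  · refine ⟨b ^ (2 * q), hP.pow _, (hb.pow_one _).mono (by norm_num),
      (hs (2 * q) (by omega)).mono ?_, ?_⟩
    · have : (1 : ℝ) ≤ q := by exact_mod_cast hq
      gcongr
      push_cast
      linarith
    · rw [sub_self]
      exact OpBound.zero.mono (by positivity)

/-! ### Second order expansion of operator powers -/

/-- Convolving the difference of two laws with matching first and second moments with a smoothing
power gains the factor `n ^ (-3 / 2)`. -/
lemma SmoothingPowers.exists_opBound_sub_mul_pow {μ ν : Measure ℝ} [IsProbabilityMeasure μ]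
    [IsProbabilityMeasure ν] (hμ : Integrable (fun y => |y| ^ 3) μ)
    (hν : Integrable (fun y => |y| ^ 3) ν) (hmom : ∀ j < 3, ∫ y, y ^ j ∂μ = ∫ y, y ^ j ∂ν)
    {a : Module.End ℝ BddMeas} (ha : OpBound a 1) (hs : SmoothingPowers a) :
    ∃ C : ℝ, 0 ≤ C ∧ ∀ m : ℕ,
      OpBound ((convOp μ - convOp ν) * a ^ m) (C / √((m : ℝ) + 1) ^ 3) := by
  obtain ⟨E, hE, hA⟩ := hs
  set m3 := ∫ y, |y| ^ 3 ∂μ + ∫ y, |y| ^ 3 ∂ν with hm3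
  have hm30 : 0 ≤ m3 := add_nonneg (integral_nonneg fun _ => by positivity)
    (integral_nonneg fun _ => by positivity)
  refine ⟨27 * (E ^ 3 * m3 + 14 * E), by positivity, fun m => ?_⟩
  -- Three blocks `a ^ (2 * q)` are replaced by `A` one at a time. The product `A ^ 3` absorbs three
  -- derivatives, and the replacement errors total 2(1 + 2 + 4) = 14 times `E / s ^ 3`. The 27 comes
  -- from √(m+1) ≤ 3s.
  obtain ⟨A, hP, hA2, hAs, hAr⟩ := hA (m / 6)
  set q := m / 6 with hq
  set s := √((q : ℝ) + 1) with hsdef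
  have hspos : 0 < s := Real.sqrt_pos.2 (by positivity)
  have hX : OpBound (a ^ (2 * q)) 1 := ha.pow_one _
  have hD : OpBound (convOp μ - convOp ν) 2 :=
    ((opBound_convOp_one μ).sub (opBound_convOp_one ν)).mono (by norm_num)
  have e : (convOp μ - convOp ν) * a ^ m = ((convOp μ - convOp ν) * A ^ 3
      + (convOp μ - convOp ν) * (a ^ (2 * q) * a ^ (2 * q) * (a ^ (2 * q) - A)
        + a ^ (2 * q) * (a ^ (2 * q) - A) * A + (a ^ (2 * q) - A) * (A * A))) * a ^ (m - 6 * q) := by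
    have : a ^ m = a ^ (2 * q) * a ^ (2 * q) * a ^ (2 * q) * a ^ (m - 6 * q) := by
      rw [← pow_add, ← pow_add, ← pow_add]
      congr 1
      omega
    rw [this, pow_succ A 2, pow_two]
    noncomm_ring
  rw [e]
  have hb := ((opBound_convOp_sub_mul_pow hμ hν hmom hAs hP).add
    (hD.mul ((((hX.mul hX).mul hAr).add ((hX.mul hAr).mul hA2)).add
      (hAr.mul (hA2.mul hA2))))).mul (ha.pow_one (m - 6 * q))
  refine hb.mono ?_
  rw [← hm3]
  have hle : √((m : ℝ) + 1) ≤ 3 * s := by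
    rw [Real.sqrt_le_left (by positivity), mul_pow, hsdef, Real.sq_sqrt (by positivity)]
    have : m + 1 ≤ 9 * (q + 1) := by omega
    have : ((m + 1 : ℕ) : ℝ) ≤ ((9 * (q + 1) : ℕ) : ℝ) := by exact_mod_cast this
    push_cast at this
    linarith
  have hmpos : 0 < √((m : ℝ) + 1) := Real.sqrt_pos.2 (by positivity)
  calc _ = (E ^ 3 * m3 + 14 * E) / s ^ 3 := by
        field_simp
        ring
    _ = 27 * (E ^ 3 * m3 + 14 * E) / (3 * s) ^ 3 := by
        field_simp
        ring
    _ ≤ _ := by gcongr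

/-- Second order telescoping of the difference of two powers. -/
lemma Commute.pow_sub_pow_sub_mul {R : Type*} [Ring R] {a b : R} (h : Commute a b) (N : ℕ) :
    a ^ (N + 1) - b ^ (N + 1) - ((N + 1 : ℕ) : R) * ((a - b) * b ^ N)
      = ∑ l ∈ Finset.range N, ((l + 1 : ℕ) : R) * ((a - b) * (a - b) * (b ^ l * a ^ (N - 1 - l))) := by
  induction N with
  | zero => simp
  | succ N ih =>
    -- The coefficients do not depend on `N`, so the old terms are only multiplied by `a` on the
    -- right, and `l = N` is new.
    have e : ∑ l ∈ Finset.range N, ((l + 1 : ℕ) : R)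
        * ((a - b) * (a - b) * (b ^ l * a ^ (N + 1 - 1 - l)))
        = (∑ l ∈ Finset.range N, ((l + 1 : ℕ) : R)
          * ((a - b) * (a - b) * (b ^ l * a ^ (N - 1 - l)))) * a := by
      rw [Finset.sum_mul]
      refine Finset.sum_congr rfl fun l hl => ?_
      have : N + 1 - 1 - l = N - 1 - l + 1 := by
        have := Finset.mem_range.1 hl
        omega
      rw [this, pow_succ]
      simp only [mul_assoc]
    rw [Finset.sum_range_succ, e, ← ih]
    have hN : b ^ N * a = a * b ^ N := (h.pow_right N).symm.eq
    have hN1 : b ^ (N + 1) * a = a * b ^ (N + 1) := (h.pow_right (N + 1)).symm.eq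
    simp only [Nat.add_sub_cancel, Nat.sub_self, pow_zero, mul_one]
    have e1 : (a ^ (N + 1) - b ^ (N + 1) - ((N + 1 : ℕ) : R) * ((a - b) * b ^ N)) * a
        = a ^ (N + 1 + 1) - a * b ^ (N + 1) - ((N + 1 : ℕ) : R) * ((a - b) * (a * b ^ N)) := by
      rw [sub_mul, sub_mul, ← pow_succ, hN1, mul_assoc _ _ a, mul_assoc _ _ a, hN]
    rw [e1]
    have e2 : b ^ (N + 1 + 1) = b * b ^ (N + 1) := pow_succ' b (N + 1)
    have e3 : b ^ (N + 1) = b * b ^ N := pow_succ' b N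
    rw [e2, e3]
    push_cast
    noncomm_ring

lemma OpBound.natCast_mul {A : Module.End ℝ BddMeas} {c : ℝ} (hA : OpBound A c) (n : ℕ) :
    OpBound ((n : Module.End ℝ BddMeas) * A) (n * c) := by
  rw [← nsmul_eq_mul, ← Nat.cast_smul_eq_nsmul ℝ]
  simpa using hA.smul (n : ℝ)

/-- By commutation each `Δ` receives half of the power, and the two gains of order -3/2 multiply to
-3. Each half has exponent i with i + 1 ≥ K/4, whence 64 = (2³)². -/
lemma opBound_sq_mul_pow {Δ c : Module.End ℝ BddMeas} (hc : Commute Δ c) {C : ℝ} (hC : 0 ≤ C)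
    (h : ∀ m : ℕ, OpBound (Δ * c ^ m) (C / √((m : ℝ) + 1) ^ 3)) {j K : ℕ} (hK : 1 ≤ K)
    (hKj : K ≤ 2 * j + 1) : OpBound (Δ * Δ * c ^ j) (64 * C ^ 2 / (K : ℝ) ^ 3) := by
  have e : Δ * Δ * c ^ j = (Δ * c ^ (j / 2)) * (Δ * c ^ (j - j / 2)) := by
    have h1 : c ^ j = c ^ (j / 2) * c ^ (j - j / 2) := by
      rw [← pow_add]
      congr 1
      omega
    have h2 : Δ * c ^ (j / 2) = c ^ (j / 2) * Δ := (hc.pow_right _).eq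
    rw [h1, mul_assoc, ← mul_assoc Δ (c ^ (j / 2)), h2]
    simp only [← mul_assoc]
    rw [h2]
  have hKpos : (0 : ℝ) < K := by exact_mod_cast hK
  set s := √(K : ℝ) with hs
  have hspos : 0 < s := Real.sqrt_pos.2 hKpos
  have hle : ∀ i : ℕ, K ≤ 4 * (i + 1) → C / √((i : ℝ) + 1) ^ 3 ≤ C / (s / 2) ^ 3 := by
    intro i hi
    have hi' : (K : ℝ) ≤ 4 * (i + 1) := by exact_mod_cast hi
    gcongr
    rw [hs]
    apply Real.le_sqrt_of_sq_le
    rw [div_pow, Real.sq_sqrt hKpos.le]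
    linarith
  rw [e]
  refine ((h _).mul (h _)).mono ?_
  calc _ ≤ C / (s / 2) ^ 3 * (C / (s / 2) ^ 3) :=
        mul_le_mul (hle _ (by omega)) (hle _ (by omega)) (by positivity) (by positivity)
    _ = 64 * C ^ 2 / (s ^ 2) ^ 3 := by
        field_simp
        ring
    _ = _ := by rw [hs, Real.sq_sqrt hKpos.le]

/-- The remainder of the first order expansion of `a ^ (N + 1)` about `b ^ (N + 1)`. -/
lemma opBound_pow_sub_pow_sub_mul {a b : Module.End ℝ BddMeas} (hab : Commute a b)
    (ha : OpBound a 1) (hb : OpBound b 1) {C : ℝ} (hC : 0 ≤ C)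
    (hΔa : ∀ m : ℕ, OpBound ((a - b) * a ^ m) (C / √((m : ℝ) + 1) ^ 3))
    (hΔb : ∀ m : ℕ, OpBound ((a - b) * b ^ m) (C / √((m : ℝ) + 1) ^ 3)) (N : ℕ) :
    OpBound (a ^ (N + 1) - b ^ (N + 1) - ((N + 1 : ℕ) : Module.End ℝ BddMeas) * ((a - b) * b ^ N))
      (128 * C ^ 2 / ((N : ℝ) + 1)) := by
  rw [hab.pow_sub_pow_sub_mul]
  have hca : Commute (a - b) a := (Commute.refl a).sub_left hab.symm
  have hcb : Commute (a - b) b := hab.sub_left (Commute.refl b)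
  have hterm : ∀ l ∈ Finset.range N, OpBound (((l + 1 : ℕ) : Module.End ℝ BddMeas)
      * ((a - b) * (a - b) * (b ^ l * a ^ (N - 1 - l)))) (N * (64 * C ^ 2 / (N : ℝ) ^ 3)) := by
    intro l hl
    have hl := Finset.mem_range.1 hl
    have h1 : OpBound ((a - b) * (a - b) * (b ^ l * a ^ (N - 1 - l)))
        (64 * C ^ 2 / (N : ℝ) ^ 3) := by
      -- The larger exponent is at least (N - 1)/2 and serves both differences; the other power is a
      -- contraction.
      rcases le_total l (N - 1 - l) with h | h
      · have := (opBound_sq_mul_pow hca hC hΔa (by omega : 1 ≤ N)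
          (by omega : N ≤ 2 * (N - 1 - l) + 1)).mul (hb.pow_one l)
        rw [mul_one] at this
        rwa [(hab.symm.pow_pow l (N - 1 - l)).eq, ← mul_assoc]
      · have := (opBound_sq_mul_pow hcb hC hΔb (by omega : 1 ≤ N)
          (by omega : N ≤ 2 * l + 1)).mul (ha.pow_one (N - 1 - l))
        rw [mul_one] at this
        rwa [← mul_assoc]
    refine (h1.natCast_mul (l + 1)).mono ?_
    gcongr
    omega
  refine (OpBound.sum _ hterm).mono ?_
  rw [Finset.sum_const, Finset.card_range, nsmul_eq_mul]
  rcases Nat.eq_zero_or_pos N with rfl | hN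
  · simp only [Nat.cast_zero, zero_mul]
    positivity
  · have hN1 : (1 : ℝ) ≤ N := by exact_mod_cast hN
    calc (N : ℝ) * (N * (64 * C ^ 2 / (N : ℝ) ^ 3)) = 128 * C ^ 2 / (2 * N) := by
          field_simp
          ring
      _ ≤ _ := by
          gcongr
          linarith

lemma IsDeriv.unique {f g g' : BddMeas} (h : IsDeriv f g) (h' : IsDeriv f g') : g = g' :=
  BddMeas.ext' fun x => (h x).unique (h' x)

/-! ### Rescaling and Gaussian averages -/

/-- Rescaling of the argument of a bounded function. -/
noncomputable def BddMeas.scale (c : ℝ) (f : BddMeas) : BddMeas :=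
  ⟨fun x => f (c * x), f.measurable.comp (measurable_const_mul c), by
    obtain ⟨M, hM⟩ := f.exists_bound
    exact ⟨M, fun x => hM _⟩⟩

lemma BddMeas.scale_apply (c : ℝ) (f : BddMeas) (x : ℝ) : f.scale c x = f (c * x) := rfl

lemma IsDeriv.scale {f f' : BddMeas} (h : IsDeriv f f') (c : ℝ) :
    IsDeriv (f.scale c) (c • f'.scale c) := fun x => by
  have := (h (c * x)).comp x ((hasDerivAt_id x).const_mul c)
  refine this.congr_deriv ?_
  rw [BddMeas.smul_apply, BddMeas.scale_apply, mul_one, mul_comm]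

section Gaussian

lemma hasDerivAt_gaussianPDFReal (x : ℝ) : HasDerivAt (gaussianPDFReal 0 1) (-(x * gaussianPDFReal 0 1 x)) x := by
  have h1 : HasDerivAt (fun x : ℝ => -(x - 0) ^ 2 / (2 * ((1 : ℝ≥0) : ℝ))) (-x) x := by
    refine ((((hasDerivAt_id x).sub_const 0).pow 2).neg.div_const _).congr_deriv ?_
    simp only [id, sub_zero, NNReal.coe_one]
    ring
  have h2 := h1.exp.const_mul (√(2 * Real.pi * ((1 : ℝ≥0) : ℝ)))⁻¹
  refine h2.congr_deriv ?_
  rw [gaussianPDFReal]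
  ring

lemma integrable_abs_pow_gaussianReal (n : ℕ) :
    Integrable (fun y : ℝ => |y| ^ n) (gaussianReal 0 1) := by
  have := (memLp_id_gaussianReal (μ := 0) (v := 1) n).integrable_norm_pow'
  simpa using this

lemma integrable_pow_gaussianReal (n : ℕ) :
    Integrable (fun y : ℝ => y ^ n) (gaussianReal 0 1) :=
  integrable_pow_of_integrable_abs_pow (integrable_abs_pow_gaussianReal n) le_rfl

lemma integrable_gaussianReal_iff (g : ℝ → ℝ) :
    Integrable g (gaussianReal 0 1) ↔ Integrable fun y => g y * gaussianPDFReal 0 1 y := by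
  rw [gaussianReal_of_var_ne_zero _ one_ne_zero,
    integrable_withDensity_iff_integrable_smul' (by fun_prop) (by simp [gaussianPDF])]
  simp [toReal_gaussianPDF, mul_comm]

lemma integral_gaussianReal_eq (g : ℝ → ℝ) :
    ∫ y, g y ∂(gaussianReal 0 1) = ∫ y, g y * gaussianPDFReal 0 1 y := by
  rw [integral_gaussianReal_eq_integral_smul one_ne_zero]
  simp [mul_comm]

lemma integral_sq_gaussianReal : ∫ y, y ^ 2 ∂(gaussianReal 0 1) = 1 := by
  have h := variance_id_gaussianReal (μ := 0) (v := 1)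
  rw [variance_eq_sub (memLp_id_gaussianReal 2)] at h
  simpa using h

lemma integral_cube_gaussianReal : ∫ y, y ^ 3 ∂(gaussianReal 0 1) = 0 := by
  have h := integral_map (μ := gaussianReal 0 1) (φ := fun x : ℝ => -x)
    (f := fun y : ℝ => y ^ 3) (by fun_prop) (by fun_prop)
  rw [gaussianReal_map_neg, neg_zero] at h
  have e : ∀ x : ℝ, (-x) ^ 3 = -x ^ 3 := fun x => by ring
  simp only [e, integral_neg] at h
  linarith

lemma smoothBy_convOp_gaussianReal_pow {k : ℕ} (hk : 1 ≤ k) :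
    SmoothBy (convOp (gaussianReal 0 1) ^ k) (1 / √k) := by
  have h := smoothBy_convOp_pow (U := gaussianReal 0 1) (u := gaussianPDFReal 0 1) (w := fun x => x)
    (gaussianReal_of_var_ne_zero _ one_ne_zero) (gaussianPDFReal_nonneg 0 1)
    (integrable_gaussianPDFReal 0 1) hasDerivAt_gaussianPDFReal measurable_id
    ((integrable_gaussianReal_iff _).1 (integrable_pow_gaussianReal 2)) hk
  rwa [← integral_gaussianReal_eq, integral_sq_gaussianReal, Real.sqrt_one] at h

lemma convOp_gaussianReal_pow (n : ℕ) :
    convOp (gaussianReal 0 1) ^ n = convOp (gaussianReal 0 n) := by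
  induction n with
  | zero =>
    ext f x
    rw [convOp_apply]
    simp [gaussianReal_zero_var]
  | succ n ih =>
    rw [pow_succ, ih, convOp_mul]
    congr 1
    rw [gaussianReal_conv_gaussianReal]
    simp

/-- The normalised Gaussian averages of a rescaled function. -/
lemma convOp_gaussianReal_pow_scale {n : ℕ} (hn : 1 ≤ n) (f : BddMeas) :
    (convOp (gaussianReal 0 1) ^ n) (f.scale (1 / √n))
      = (convOp (gaussianReal 0 1) f).scale (1 / √n) := by
  have hpos : (0 : ℝ) < √n := Real.sqrt_pos.2 (by exact_mod_cast hn)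
  have hmap : gaussianReal 0 (n : ℝ≥0) = (gaussianReal 0 1).map (fun x => √n * x) := by
    rw [gaussianReal_map_const_mul]
    congr 1
    · simp
    · ext
      simp
  ext x
  rw [convOp_gaussianReal_pow, convOp_apply, scale_apply, convOp_apply, hmap, integral_map]
  · refine integral_congr_ae (Eventually.of_forall fun z => ?_)
    simp only [scale_apply]
    field_simp
  · fun_prop
  · exact ((f.scale _).measurable.comp (by fun_prop)).aestronglyMeasurable

/-- The third derivative of a Gaussian average. -/
lemma exists_derivs_convOp_gaussianReal (f : BddMeas) :
    ∃ f₁ f₂ f₃ : BddMeas, IsDeriv (convOp (gaussianReal 0 1) f) f₁ ∧ IsDeriv f₁ f₂ ∧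
      IsDeriv f₂ f₃ ∧ f₃ 0 = ∫ z, (z ^ 3 - 3 * z) * f z ∂(gaussianReal 0 1) := by
  have i1 : Integrable fun x => x * gaussianPDFReal 0 1 x := (integrable_gaussianReal_iff fun x => x).1
    (by simpa using integrable_pow_gaussianReal 1)
  have i2 : Integrable fun x => (x ^ 2 - 1) * gaussianPDFReal 0 1 x := (integrable_gaussianReal_iff _).1
    ((integrable_pow_gaussianReal 2).sub (integrable_const 1))
  have i3 : Integrable fun x => (x ^ 3 - 3 * x) * gaussianPDFReal 0 1 x := (integrable_gaussianReal_iff _).1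
    ((integrable_pow_gaussianReal 3).sub
      (by simpa using (integrable_pow_gaussianReal 1).const_mul 3))
  -- Each derivative of a Hermite polynomial times the Gaussian density is minus the next such
  -- product; this sign cancels the one from moving the derivative onto the density.
  have key : ∀ {v w : ℝ → ℝ} (hv : Integrable v) (hw : Integrable w),
      (∀ x, HasDerivAt v (-w x) x) → IsDeriv (kernelOp v hv f) (kernelOp w hw f) := by
    intro v w hv hw hd
    have h := isDeriv_kernelOp hv hw.neg hd f
    have e : -(kernelOp _ hw.neg f) = kernelOp w hw f := by
      ext x
      change -(∫ y, f (x + y) * -(w y)) = ∫ y, f (x + y) * w y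
      rw [← integral_neg]
      simp
    rwa [e] at h
  refine ⟨kernelOp _ i1 f, kernelOp _ i2 f, kernelOp _ i3 f, ?_, ?_, ?_, ?_⟩
  · have e : convOp (gaussianReal 0 1) f = kernelOp (gaussianPDFReal 0 1) (integrable_gaussianPDFReal 0 1) f :=
      BddMeas.ext' fun x => integral_gaussianReal_eq _
    rw [e]
    exact key _ _ hasDerivAt_gaussianPDFReal
  · refine key _ _ fun x => ?_
    refine ((hasDerivAt_id x).mul (hasDerivAt_gaussianPDFReal x)).congr_deriv ?_
    simp only [id]
    ring
  · refine key _ _ fun x => ?_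
    have h2 : HasDerivAt (fun x : ℝ => x ^ 2 - 1) (2 * x) x := by
      simpa using (hasDerivAt_pow 2 x).sub_const 1
    refine (h2.mul (hasDerivAt_gaussianPDFReal x)).congr_deriv ?_
    ring
  · rw [kernelOp_apply, integral_gaussianReal_eq]
    refine integral_congr_ae (Eventually.of_forall fun z => ?_)
    simp only [zero_add]
    ring

/-! ### The leading term -/

/-- The leading term of the expansion, up to a second order error. -/
lemma exists_convOp_sub_mul_pow_apply_le {μ ν : Measure ℝ} [IsProbabilityMeasure μ]
    [IsProbabilityMeasure ν] {γ : ℝ}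
    (hμ1 : ∫ x, x ∂μ = 0) (hμ2 : ∫ x, x ^ 2 ∂μ = 1) (hμ3 : ∫ x, x ^ 3 ∂μ = γ)
    (hμ4 : Integrable (fun x : ℝ => |x| ^ 4) μ)
    (hν1 : ∫ x, x ∂ν = 0) (hν2 : ∫ x, x ^ 2 ∂ν = 1) (hν3 : ∫ x, x ^ 3 ∂ν = 0)
    (hν4 : Integrable (fun x : ℝ => |x| ^ 4) ν)
    (hs : ∀ k : ℕ, 1 ≤ k → SmoothBy (convOp ν ^ k) (1 / √k)) :
    ∃ C : ℝ, 0 ≤ C ∧ ∀ (N : ℕ) (f f₁ f₂ f₃ : BddMeas), 4 ≤ N → f.BoundedBy 1 →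
      IsDeriv ((convOp ν ^ (N + 1)) f) f₁ → IsDeriv f₁ f₂ → IsDeriv f₂ f₃ →
      |((convOp μ - convOp ν) * convOp ν ^ N) f 0 - γ / 6 * f₃ 0| ≤ C / ((N : ℝ) + 1) ^ 2 := by
  set b := convOp ν with hb
  set A₁ := ∫ y, |y| ^ 4 ∂μ with hA₁
  set A₂ := ∫ y, |y| ^ 4 ∂ν with hA₂
  set A₃ := ∫ y, |y| ^ 1 ∂ν with hA₃
  have hA₁0 : 0 ≤ A₁ := integral_nonneg fun _ => by positivity
  have hA₂0 : 0 ≤ A₂ := integral_nonneg fun _ => by positivity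
  have hA₃0 : 0 ≤ A₃ := integral_nonneg fun _ => by positivity
  refine ⟨64 * (A₁ + A₂ + |γ| / 6 * A₃), by positivity, ?_⟩
  intro N f f₁ f₂ f₃ hN hf hf1 hf2 hf3
  have hbP : PreservesDeriv b := PreservesDeriv.convOp ν
  set q := N / 4 with hq
  have hq1 : 1 ≤ q := by omega
  -- Four blocks `b ^ q` inside `b ^ N` pay for four derivatives, at cost q^(-1/2) each.
  obtain ⟨g, hg0, hg, hg4⟩ := (hs q hq1).exists_derivs
    (hbP.pow q) 4 ((b ^ (N - 4 * q)) f) 1 (by simpa using (opBound_convOp_one ν).pow_one _ f 1 hf)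
  have hqpos : (0 : ℝ) < q := by exact_mod_cast hq1
  have hgN : g 0 = (b ^ N) f := by
    rw [hg0, ← Module.End.mul_apply, ← pow_mul, ← pow_add]
    congr 2
    omega
  have hbound : (1 / √(q : ℝ)) ^ 4 * 1 = 1 / (q : ℝ) ^ 2 := by
    rw [div_pow, mul_one, one_pow, show (4 : ℕ) = 2 * 2 by norm_num, pow_mul,
      Real.sq_sqrt hqpos.le]
  rw [hbound] at hg4
  -- Taylor expansion produces the third derivative of `b ^ N` applied to `f`, whereas `f₃` belongs
  -- to `b ^ (N + 1)`. One more averaging links them, and its first order remainder `t3` is also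
  -- O(q^(-2)).
  have hbg : b (g 3) = f₃ := by
    have e0 : b (g 0) = (b ^ (N + 1)) f := by
      rw [hgN, pow_succ']
      rfl
    have e1 : b (g 1) = f₁ := (hbP _ _ (hg 0 (by norm_num))).unique (by rw [e0]; exact hf1)
    have e2 : b (g 2) = f₂ := (hbP _ _ (hg 1 (by norm_num))).unique (by rw [e1]; exact hf2)
    exact (hbP _ _ (hg 2 (by norm_num))).unique (by rw [e2]; exact hf3)
  have t1 := abs_convOp_sub_taylor_le hμ4 hg hg4 0
  have t2 := abs_convOp_sub_taylor_le hν4 hg hg4 0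
  have hν1i : Integrable (fun x : ℝ => |x| ^ 1) ν := by
    simpa using (integrable_pow_of_integrable_abs_pow hν4 (j := 1) (by norm_num)).abs
  have t3 := abs_convOp_sub_taylor_le hν1i
    (g := fun k => g (k + 3)) (fun k hk => hg (k + 3) (by omega)) hg4 0
  rw [← hA₁] at t1
  rw [← hA₂] at t2
  rw [← hA₃] at t3
  simp only [Finset.sum_range_succ, Finset.sum_range_zero, pow_zero, pow_one, hμ1, hμ2,
    hμ3, Nat.factorial] at t1
  simp only [Finset.sum_range_succ, Finset.sum_range_zero, pow_zero, pow_one, hν1, hν2,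
    hν3, Nat.factorial] at t2
  simp only [Finset.sum_range_succ, Finset.sum_range_zero, pow_zero, Nat.factorial, zero_add,
    ← hb, hbg] at t3
  norm_num at t1 t2 t3
  have hval : ((convOp μ - b) * b ^ N) f 0 = convOp μ (g 0) 0 - b (g 0) 0 := by rw [hgN]; rfl
  have hγ := abs_mul (γ / 6) (f₃ 0 - g 3 0)
  rw [abs_div, abs_of_pos (by norm_num : (0 : ℝ) < 6)] at hγ
  have t4 := mul_le_mul_of_nonneg_left t3 (by positivity : 0 ≤ |γ| / 6)
  rw [← hγ] at t4
  have hfin : |((convOp μ - b) * b ^ N) f 0 - γ / 6 * f₃ 0|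
      ≤ ((q : ℝ) ^ 2)⁻¹ * (A₁ + A₂ + |γ| / 6 * A₃) := by
    rw [hval]
    obtain ⟨t1a, t1b⟩ := abs_le.1 t1
    obtain ⟨t2a, t2b⟩ := abs_le.1 t2
    obtain ⟨t4a, t4b⟩ := abs_le.1 t4
    rw [abs_le]
    constructor <;> linarith
  refine hfin.trans ?_
  rw [inv_mul_eq_div, div_le_div_iff₀ (by positivity) (by positivity)]
  -- Squaring this accounts for the factor 64.
  have hNq : (N : ℝ) + 1 ≤ 8 * q := by
    have : N + 1 ≤ 8 * q := by omega
    exact_mod_cast this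
  have hsq : ((N : ℝ) + 1) ^ 2 ≤ (8 * q) ^ 2 := pow_le_pow_left₀ (by positivity) hNq 2
  have hA : 0 ≤ A₁ + A₂ + |γ| / 6 * A₃ := by positivity
  refine (mul_le_mul_of_nonneg_left hsq hA).trans (le_of_eq ?_)
  ring

end Gaussian

/-! ### The Edgeworth expansion -/

/-- The Edgeworth expansion in terms of convolution operators. -/
lemma HasContinuousComponent.exists_edgeworth {μ : Measure ℝ} [IsProbabilityMeasure μ] {γ : ℝ}
    (h_mean : ∫ x, x ∂μ = 0) (h_var : ∫ x, x ^ 2 ∂μ = 1) (h_third : ∫ x, x ^ 3 ∂μ = γ)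
    (h_fourth : Integrable (fun x : ℝ => x ^ 4) μ) (h_comp : HasContinuousComponent μ) :
    ∃ C : ℝ, 0 ≤ C ∧ ∀ n : ℕ, 5 ≤ n → ∀ f : BddMeas, f.BoundedBy 1 →
      |(convOp μ ^ n) (f.scale (1 / √n)) 0 - (∫ z, f z ∂(gaussianReal 0 1))
        - γ / (6 * √(n : ℝ)) * ∫ z, (z ^ 3 - 3 * z) * f z ∂(gaussianReal 0 1)| ≤ C / n := by
  have hμ4 : Integrable (fun x : ℝ => |x| ^ 4) μ := by
    simpa [Even.pow_abs (by decide : Even 4)] using h_fourth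
  have hμ3 : Integrable (fun x : ℝ => |x| ^ 3) μ := by
    simpa [abs_pow] using (integrable_pow_of_integrable_abs_pow hμ4 (j := 3) (by norm_num)).abs
  have hν3 := integrable_abs_pow_gaussianReal 3
  have hmom : ∀ j < 3, ∫ y, y ^ j ∂μ = ∫ y, y ^ j ∂(gaussianReal 0 1) := by
    intro j hj
    interval_cases j
    · simp
    · simp [h_mean, integral_id_gaussianReal]
    · rw [h_var, integral_sq_gaussianReal]
  have hab : Commute (convOp μ) (convOp (gaussianReal 0 1)) := convOp_commute _ _
  have ha1 := opBound_convOp_one μ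
  have hb1 := opBound_convOp_one (gaussianReal 0 1)
  obtain ⟨Ca, hCa, hΔa⟩ := h_comp.smoothingPowers.exists_opBound_sub_mul_pow hμ3 hν3 hmom ha1
  obtain ⟨Cb, hCb, hΔb⟩ := (smoothingPowers_of_smoothBy hb1 (PreservesDeriv.convOp _) fun k hk =>
    smoothBy_convOp_gaussianReal_pow hk).exists_opBound_sub_mul_pow hμ3 hν3 hmom hb1
  obtain ⟨Cm, hCm, hmain⟩ := exists_convOp_sub_mul_pow_apply_le h_mean h_var h_third hμ4
    integral_id_gaussianReal integral_sq_gaussianReal integral_cube_gaussianReal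
    (integrable_abs_pow_gaussianReal 4) fun k hk => smoothBy_convOp_gaussianReal_pow hk
  set a := convOp μ with ha
  set b := convOp (gaussianReal 0 1) with hb
  have hrem := opBound_pow_sub_pow_sub_mul hab ha1 hb1 (le_max_of_le_left hCa : 0 ≤ max Ca Cb)
    (fun m => (hΔa m).mono (by gcongr; exact le_max_left _ _))
    (fun m => (hΔb m).mono (by gcongr; exact le_max_right _ _))
  refine ⟨128 * max Ca Cb ^ 2 + Cm, by positivity, ?_⟩
  intro n hn f hf
  obtain ⟨N, rfl⟩ : ∃ N, n = N + 1 := ⟨n - 1, by omega⟩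
  set c : ℝ := 1 / √((N + 1 : ℕ) : ℝ) with hc
  have hpos : (0 : ℝ) < ((N + 1 : ℕ) : ℝ) := by positivity
  have hspos : 0 < √((N + 1 : ℕ) : ℝ) := Real.sqrt_pos.2 hpos
  have hss : √((N + 1 : ℕ) : ℝ) ^ 2 = ((N + 1 : ℕ) : ℝ) := Real.sq_sqrt hpos.le
  have hfc : (f.scale c).BoundedBy 1 := fun x => hf _
  obtain ⟨G1, G2, G3, hG1, hG2, hG3, hG⟩ := exists_derivs_convOp_gaussianReal f
  have hbn : (b ^ (N + 1)) (f.scale c) = (b f).scale c :=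
    convOp_gaussianReal_pow_scale (by omega) f
  have hd1 : IsDeriv ((b ^ (N + 1)) (f.scale c)) (c • G1.scale c) := by
    rw [hbn]
    exact hG1.scale c
  have hm := hmain N (f.scale c) _ _ _ (by omega) hfc hd1 ((hG2.scale c).const_smul c)
    (((hG3.scale c).const_smul c).const_smul c)
  have hr := hrem N (f.scale c) 1 hfc 0
  have hr' : |(a ^ (N + 1)) (f.scale c) 0 - (b ^ (N + 1)) (f.scale c) 0
      - ((N + 1 : ℕ) : ℝ) * ((a - b) * b ^ N) (f.scale c) 0|
      ≤ 128 * max Ca Cb ^ 2 / ((N : ℝ) + 1) := by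
    rw [mul_one] at hr
    have e : (((N + 1 : ℕ) : Module.End ℝ BddMeas) * ((a - b) * b ^ N)) (f.scale c)
        = ((N + 1 : ℕ) : ℝ) • (((a - b) * b ^ N) (f.scale c)) := by
      rw [← nsmul_eq_mul, ← Nat.cast_smul_eq_nsmul ℝ]
      rfl
    rw [LinearMap.sub_apply, LinearMap.sub_apply, e] at hr
    exact hr
  have hb0 : (b ^ (N + 1)) (f.scale c) 0 = ∫ z, f z ∂(gaussianReal 0 1) := by
    rw [hbn, scale_apply, hb, convOp_apply]
    simp
  rw [hb0] at hr'
  have hG30 : (c • c • c • G3.scale c) 0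
      = c ^ 3 * ∫ z, (z ^ 3 - 3 * z) * f z ∂(gaussianReal 0 1) := by
    simp only [BddMeas.smul_apply, scale_apply, mul_zero, hG]
    ring
  rw [hG30] at hm
  set T := ∫ z, (z ^ 3 - 3 * z) * f z ∂(gaussianReal 0 1) with hT
  have hm' := mul_le_mul_of_nonneg_left hm hpos.le
  rw [← abs_of_pos hpos, ← abs_mul, abs_of_pos hpos] at hm'
  have e1 : ((N + 1 : ℕ) : ℝ) * (Cm / ((N : ℝ) + 1) ^ 2) = Cm / ((N + 1 : ℕ) : ℝ) := by
    push_cast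
    field_simp
  -- Three derivatives of the rescaled function give `c ^ 3`, and n · n^(-3/2) = 1/√n is the order
  -- of the correction.
  have e2 : ((N + 1 : ℕ) : ℝ) * (((a - b) * b ^ N) (f.scale c) 0 - γ / 6 * (c ^ 3 * T))
      = ((N + 1 : ℕ) : ℝ) * ((a - b) * b ^ N) (f.scale c) 0
        - γ / (6 * √((N + 1 : ℕ) : ℝ)) * T := by
    rw [mul_sub, hc]
    congr 1
    nth_rewrite 1 [← hss]
    field_simp
  have e3 : (128 * max Ca Cb ^ 2 + Cm) / ((N + 1 : ℕ) : ℝ)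
      = 128 * max Ca Cb ^ 2 / ((N : ℝ) + 1) + Cm / ((N + 1 : ℕ) : ℝ) := by
    push_cast
    rw [add_div]
  rw [e1, e2] at hm'
  rw [e3]
  refine le_trans (le_of_eq ?_) ((abs_add_le _ _).trans (add_le_add hr' hm'))
  congr 1
  ring

theorem theorem1 (μ : Measure ℝ) [IsProbabilityMeasure μ] (γ : ℝ)
    (h_mean : ∫ x, x ∂μ = 0)
    (h_var : ∫ x, x ^ 2 ∂μ = 1)
    (h_third : ∫ x, x ^ 3 ∂μ = γ)
    (h_fourth : Integrable (fun x : ℝ => x ^ 4) μ)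
    (h_comp : HasContinuousComponent μ) :
    (∃ C : ℝ, ∀ n : ℕ, 1 ≤ n →
      ∀ (Ω : Type*) [MeasurableSpace Ω] (P : Measure Ω) [IsProbabilityMeasure P]
        (X : Fin n → Ω → ℝ),
        iIndepFun X P → (∀ i, HasLaw (X i) μ P) →
        ∀ h : ℝ → ℝ, Measurable h → (∀ x, |h x| ≤ 1) →
          |(∫ ω, h ((1 / √(n : ℝ)) * ∑ i, X i ω) ∂P)
              - (∫ z, h z ∂(gaussianReal 0 1))
              - γ / (6 * √(n : ℝ)) * ∫ z, (z ^ 3 - 3 * z) * h z ∂(gaussianReal 0 1)|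
            ≤ C / (n : ℝ)) ∧
    (∀ n : ℕ, 1 ≤ n → ∀ x : ℝ,
      γ / (6 * √(n : ℝ)) *
          ∫ z, (z ^ 3 - 3 * z) * (Set.Iic x).indicator (fun _ => (1 : ℝ)) z ∂(gaussianReal 0 1)
        = γ / (6 * √(2 * Real.pi * (n : ℝ))) *
          ∫ y in Set.Iic x, (y ^ 3 - 3 * y) * Real.exp (-y ^ 2 / 2)) := by
  constructor
  · obtain ⟨C, hC, hmain⟩ := h_comp.exists_edgeworth h_mean h_var h_third h_fourth
    have hint : Integrable (fun z : ℝ => z ^ 3 - 3 * z) (gaussianReal 0 1) :=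
      (integrable_pow_gaussianReal 3).sub
        (by simpa using (integrable_pow_gaussianReal 1).const_mul 3)
    set B := ∫ z, |z ^ 3 - 3 * z| ∂(gaussianReal 0 1) with hB
    have hB0 : 0 ≤ B := integral_nonneg fun _ => abs_nonneg _
    -- The operator expansion needs `n ≥ 5`. For `n ≤ 4` the trivial bound `2 + |γ| * B` is
    -- multiplied by 4 to absorb the division by `n`.
    refine ⟨C + 4 * (2 + |γ| * B), ?_⟩
    intro n hn Ω _ P _ X hX hl h hh hb
    have hn0 : (0 : ℝ) < n := by exact_mod_cast hn
    rcases le_or_gt 5 n with h5 | h5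
    · set f : BddMeas := ⟨h, hh, 1, hb⟩ with hf
      have h1 := hmain n h5 f hb
      have h2 := convOp_pow_apply hX hl (f.scale (1 / √n)) Finset.univ 0
      rw [Finset.card_univ, Fintype.card_fin] at h2
      simp only [zero_add, scale_apply] at h2
      rw [h2] at h1
      refine h1.trans ?_
      gcongr
      linarith [show 0 ≤ 4 * (2 + |γ| * B) by positivity]
    · have h1 : |∫ ω, h ((1 / √(n : ℝ)) * ∑ i, X i ω) ∂P| ≤ 1 := by
        simpa using abs_integral_le_of_bound (ρ := P)
          (f := fun ω => h ((1 / √(n : ℝ)) * ∑ i, X i ω)) fun ω => hb _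
      have h2 : |∫ z, h z ∂(gaussianReal 0 1)| ≤ 1 := by
        simpa using abs_integral_le_of_bound (ρ := gaussianReal 0 1) hb
      have h3 : |∫ z, (z ^ 3 - 3 * z) * h z ∂(gaussianReal 0 1)| ≤ B := by
        rw [← Real.norm_eq_abs]
        refine norm_integral_le_of_norm_le hint.abs (Eventually.of_forall fun z => ?_)
        rw [norm_mul]
        exact mul_le_of_le_one_right (norm_nonneg _) (hb z)
      have hs1 : 1 ≤ √(n : ℝ) := Real.one_le_sqrt.2 (by exact_mod_cast hn)
      have h4 : |γ / (6 * √(n : ℝ))| ≤ |γ| := by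
        rw [abs_div]
        refine div_le_self (abs_nonneg _) ?_
        rw [abs_of_nonneg (by positivity)]
        linarith
      have h6 := mul_le_mul h4 h3 (abs_nonneg _) (abs_nonneg γ)
      rw [← abs_mul] at h6
      have h7 : 2 + |γ| * B ≤ (C + 4 * (2 + |γ| * B)) / n := by
        rw [le_div_iff₀ hn0]
        have hn4 : (n : ℝ) ≤ 4 := by exact_mod_cast (by omega : n ≤ 4)
        have := mul_le_mul_of_nonneg_left hn4 (show 0 ≤ 2 + |γ| * B by positivity)
        linarith
      refine le_trans ?_ h7
      have := abs_sub (∫ ω, h ((1 / √(n : ℝ)) * ∑ i, X i ω) ∂P) (∫ z, h z ∂(gaussianReal 0 1))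
      refine (abs_sub _ _).trans ?_
      linarith
  · intro n hn x
    have e : ∫ z, (z ^ 3 - 3 * z) * (Set.Iic x).indicator (fun _ => (1 : ℝ)) z ∂(gaussianReal 0 1)
        = (√(2 * Real.pi))⁻¹ * ∫ y in Set.Iic x, (y ^ 3 - 3 * y) * Real.exp (-y ^ 2 / 2) := by
      rw [integral_gaussianReal_eq, ← integral_indicator measurableSet_Iic, ← integral_const_mul]
      refine integral_congr_ae (Eventually.of_forall fun z => ?_)
      by_cases hz : z ∈ Set.Iic x
      · simp only [Set.indicator_of_mem hz, gaussianPDFReal, NNReal.coe_one, mul_one, sub_zero]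
        ring
      · simp [Set.indicator_of_notMem hz]
    rw [e, Real.sqrt_mul (by positivity : 0 ≤ 2 * Real.pi) (n : ℝ)]
    generalize √(2 * Real.pi) = r
    ring
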